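/- Let $a_n=4^{-n}\binom{2n}{n}$ for $n\ge 0$. For $w\ge 0$ let $\mathrm{CMZV}^4_w\subset\mathbb C$ (resp. $\mathrm{CMZV}^4_{\le w}$) be the $\mathbb Q$-span of the colored multiple zeta values of level $4$ and weight $w$ (resp. weight at most $w$), that is, of the numbers $$\mathrm{Li}_{k_1,\dots,k_m}(z_1,\dots,z_m)=\lim_{K\to\infty}\ \sum_{K\ge n_1>\cdots>n_m>0}\frac{z_1^{n_1}\cdots z_m^{n_m}}{n_1^{k_1}\cdots n_m^{k_m}},$$ where $m\ge 0$, the $k_j$ are positive integers with $k_1+\cdots+k_m=w$ (resp. $\le w$), $z_j^4=1$ for all $j$, and $(k_1,z_1)\neq(1,1)$; for $m=0$ the value is $1$, of weight $0$. For a $\mathbb Q$-subspace $M\subset\mathbb C$ write $M\otimes\mathbb Q[i]$ for the $\mathbb Q[i]$-span of $M$ in $\mathbb C$. Let $d\ge 1$, let $\mathbf s=(s_1,\dots,s_d)$ be positive integers, and put $|\mathbf s|=s_1+\cdots+s_d$. For $2\le j\le d$ let $l_j(n)$ be $2n$ or $2n+1$, and let $l_1(n)$ be $n$, $2n$ or $2n+1$.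 For $1\le j\le d$ let $\succ_j$ be one of the symbols $>$ and $\ge$, such that no $l_j(n_j)$ vanishes on the range of summation (that is, the series below is defined). Then the series $$S=\sum_{n_1\succ_1 n_2\succ_2\cdots\succ_{d-1}n_d\succ_d 0}\frac{a_{n_1}}{l_1(n_1)^{s_1}l_2(n_2)^{s_2}\cdots l_d(n_d)^{s_d}}$$ converges, and: 1. if $l_1(n)=n$ and $\succ_1$ is $>$, then $S\in\mathrm{CMZV}^4_{\le|\mathbf s|}$; 2. if $l_1(n)=2n+1$ and $\succ_1$ is $\ge$, then $S\in i\,\mathrm{CMZV}^4_{\le|\mathbf s|}$; 3. if $l_1(n)$ is $2n$ or $2n+1$ and $\succ_1$ is arbitrary, then $S\in\mathrm{CMZV}^4_{\le|\mathbf s|}\otimes\mathbb Q[i]$. Call $\succ_j$ *standard* if it is $\ge$ when $l_j(n)=2n+1$ and $>$ otherwise. If $\succ_d$ is standard and, for every $j<d$, $\succ_j$ is standard or $l_j=l_{j+1}$, then the weight is exactly $|\mathbf s|$: in 1, 2, 3 one may replace $\mathrm{CMZV}^4_{\le|\mathbf s|}$ by $\mathrm{CMZV}^4_{|\mathbf s|}$.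 -/

import Mathlib

open scoped BigOperators

/-- Partial sum of the multiple polylogarithm:
`∑_{K ≥ n₁ > ⋯ > n_k > 0} ∏ⱼ zⱼ ^ nⱼ / nⱼ ^ sⱼ` (equal to `1` in depth `k = 0`). -/
noncomputable def polylogPartial {k : ℕ} (s : Fin k → ℕ) (z : Fin k → ℂ) (K : ℕ) : ℂ :=
  open Classical in
  ∑ n ∈ (Fintype.piFinset fun _ : Fin k => Finset.Icc 1 K).filter (fun n => StrictAnti n),
    ∏ j, z j ^ n j / (n j : ℂ) ^ s j

/-- `x` is a colored multiple zeta value of level `N` and weight `w`: the limit of the partial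
sums of `Li_s(z)` with positive integers `sⱼ` of sum `w`, with `N`-th roots of unity `zⱼ`, and with
`(s₁, z₁) ≠ (1, 1)`. The empty index gives the value `1`, of weight `0`. -/
def IsCMZV (N w : ℕ) (x : ℂ) : Prop :=
  ∃ (k : ℕ) (s : Fin k → ℕ) (z : Fin k → ℂ),
    (∀ j, 1 ≤ s j) ∧ (∀ j, z j ^ N = 1) ∧ (∑ j, s j = w) ∧
    (∀ h : 0 < k, ¬ (s ⟨0, h⟩ = 1 ∧ z ⟨0, h⟩ = 1)) ∧
    Filter.Tendsto (polylogPartial s z) Filter.atTop (nhds x)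

/-- `CMZV^N_w`: the `ℚ`-span of the CMZVs of level `N` and weight `w`. -/
noncomputable def cmzv (N w : ℕ) : Submodule ℚ ℂ := Submodule.span ℚ {x | IsCMZV N w x}

/-- `CMZV^N_{≤ w}`: the `ℚ`-span of the CMZVs of level `N` and weight at most `w`. -/
noncomputable def cmzvLE (N w : ℕ) : Submodule ℚ ℂ := Submodule.span ℚ {x | ∃ v ≤ w, IsCMZV N v x}

/-- `M ⊗ ℚ[i]`, as a space of complex numbers: the `ℚ[i]`-span of `M` in `ℂ`. -/
noncomputable def tensorQi (M : Submodule ℚ ℂ) : Submodule (Algebra.adjoin ℚ {Complex.I}) ℂ :=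
  Submodule.span (Algebra.adjoin ℚ {Complex.I}) (M : Set ℂ)

/-- `aₙ = 4⁻ⁿ * binom(2n, n)`. -/
noncomputable def aperyCoeff (n : ℕ) : ℝ := (Nat.centralBinom n : ℝ) / 4 ^ n

/-- The linear form `l(n) = 2n`. -/
def evenForm (n : ℕ) : ℕ := 2 * n

/-- The linear form `l(n) = 2n + 1`. -/
def oddForm (n : ℕ) : ℕ := 2 * n + 1

/-- One of the two symbols `>` and `≥`. -/
inductive Ineq
  | gt
  | ge

/-- The relation between natural numbers that an inequality symbol stands for. -/
def Ineq.Holds : Ineq → ℕ → ℕ → Prop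
  | .gt, m, n => m > n
  | .ge, m, n => m ≥ n

/-- Summation range `n₁ ≻₁ n₂ ≻₂ ⋯ ≻_{D-1} n_D ≻_D 0`, where `D = d + 1`; the indices
`1, …, D` are represented by `Fin (d + 1)`. -/
def chain {d : ℕ} (r : Fin (d + 1) → Ineq) : Set (Fin (d + 1) → ℕ) :=
  {n | (∀ j : Fin d, (r j.castSucc).Holds (n j.castSucc) (n j.succ)) ∧
    (r (Fin.last d)).Holds (n (Fin.last d)) 0}

/-- No denominator of the series vanishes on its summation range. -/
def SeriesDefined {d : ℕ} (l : Fin (d + 1) → ℕ → ℕ) (r : Fin (d + 1) → Ineq) : Prop :=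
  ∀ n ∈ chain r, ∀ j, l j (n j) ≠ 0

/-- The series `∑_{n₁ ≻₁ ⋯ ≻ n_D ≻_D 0} a_{n₁} / (l₁(n₁)^{s₁} ⋯ l_D(n_D)^{s_D})` converges,
with sum `S`. -/
def HasAperySum {d : ℕ} (l : Fin (d + 1) → ℕ → ℕ) (s : Fin (d + 1) → ℕ)
    (r : Fin (d + 1) → Ineq) (S : ℝ) : Prop :=
  HasSum (fun n : chain r => aperyCoeff (n.1 0) / ∏ j, (l j (n.1 j) : ℝ) ^ s j) S

/-- The symbol `q` is `≥` if `f(n) = 2n + 1`, and is `>` otherwise. -/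
def IsStandard (f : ℕ → ℕ) (q : Ineq) : Prop :=
  (f = oddForm → q = Ineq.ge) ∧ (f ≠ oddForm → q = Ineq.gt)

/-- The last symbol `≻_D` is the standard one for `l_D`, and every other symbol `≻ⱼ` is the
standard one for `lⱼ` unless `lⱼ = l_{j+1}`. -/
def IsHomogeneous {d : ℕ} (l : Fin (d + 1) → ℕ → ℕ) (r : Fin (d + 1) → Ineq) : Prop :=
  (∀ j : Fin d, l j.castSucc = l j.succ ∨ IsStandard (l j.castSucc) (r j.castSucc)) ∧
    IsStandard (l (Fin.last d)) (r (Fin.last d))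

/-! The number `aₙ` is the mean value of `cos φ ^ (2n)`. With `B(x) = ∑ β_N x ^ N`, the sum `∑ aₙ
β(2n)` for an even `B` is therefore the constant Fourier coefficient of `B(cos φ)`, and for an odd
`B` the sum `∑ aₙ β(2n+1)` is that of `B(cos φ) / cos φ`. The inner sums of the series are rational
combinations of Taylor coefficients of iterated integrals in `dx/x`, `x dx/(1-x²)`, `dx/(1-x²)`
(`AperySeq`), even exponents standing for the form `2n` and odd ones for `2n+1`.

Under `x = cos φ` each integration acts on the Fourier coefficients `c_J`, `J > 0`. For the two
forms with denominator `1-x²` the new coefficient is, in the right parity, `(c_J + 2 ∑_{0<j<J} c_j +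
c_0) / J` (`LogBound.cosTransform_sum`). For `dx/x` one divides by `cos φ`, and `J i^J` times the
new coefficient is `κ` minus a trapezoidal partial sum of `2 ∑ i^j c_j`, where `κ` is the value of
the whole series (`AperySeq.term_div`); this is where fourth roots of unity enter. So `c_J` is the
summand of a nested sum of level 4 whose coefficients are built from the constants `κ` and `c_0`.
The induction `AperySeq.coeff_mem_and_sums` shows that these constants are CMZVs of the right
weight. It also has to control `∑ i^J c_J J^{-r} f(J-1)` for nested sums `f`, because termwise
summation meets divergent words. Finally `κ = -c_0` in the even case, while in the odd case `κ` is
`i` times the wanted sum, hence the factor `i` in case 2.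

It remains to express `chainSeq` through `AperySeq`. A standard symbol is exactly the one for which
`n ≻ m` reads `M < N` for the exponents, so it preserves weight. Other steps need `1/(2n(2n+1)) =
1/(2n) - 1/(2n+1)`, which may lower the weight (`AperySeq.divForm_mem`). All the calculus is carried
out as recurrences for `cosCoeff`. -/

/-! ### Colored multiple zeta values as limits of nested sums over words. -/

/-- The operator `f ↦ (N ↦ ∑_{1 ≤ n ≤ N} zⁿ / nᵏ * f (n - 1))`. -/
noncomputable def sumOp (k : ℕ) (z : ℂ) : (ℕ → ℂ) →ₗ[ℂ] (ℕ → ℂ) where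
  toFun f N := ∑ n ∈ Finset.range N, z ^ (n + 1) / ((n : ℂ) + 1) ^ k * f n
  map_add' f g := by
    funext N
    simp [mul_add, Finset.sum_add_distrib]
  map_smul' c f := by
    funext N
    simp only [Pi.smul_apply, smul_eq_mul, RingHom.id_apply, Finset.mul_sum]
    exact Finset.sum_congr rfl fun n _ => by ring

lemma sumOp_apply (k : ℕ) (z : ℂ) (f : ℕ → ℂ) (N : ℕ) :
    sumOp k z f N = ∑ n ∈ Finset.range N, z ^ (n + 1) / ((n : ℂ) + 1) ^ k * f n := rfl

lemma sumOp_zero (k : ℕ) (z : ℂ) (f : ℕ → ℂ) : sumOp k z f 0 = 0 := by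
  simp [sumOp_apply]

lemma sumOp_succ (k : ℕ) (z : ℂ) (f : ℕ → ℂ) (N : ℕ) :
    sumOp k z f (N + 1) = sumOp k z f N + z ^ (N + 1) / ((N : ℂ) + 1) ^ k * f N := by
  simp [sumOp_apply, Finset.sum_range_succ]

/-- The nested partial sum attached to a word in the letters `(k, z)`. -/
noncomputable def nestedSum : List (ℕ × ℂ) → ℕ → ℂ
  | [] => 1
  | a :: w => sumOp a.1 a.2 (nestedSum w)

/-- The letters are `(k, z)` with `k ≥ 1` and `z ^ 4 = 1`. -/
def ValidWord (w : List (ℕ × ℂ)) : Prop := ∀ a ∈ w, 1 ≤ a.1 ∧ a.2 ^ 4 = 1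

/-- The weight of a word. -/
def wordWeight (w : List (ℕ × ℂ)) : ℕ := (w.map Prod.fst).sum

/-- The first letter is not `(1, 1)`. -/
def Admissible (w : List (ℕ × ℂ)) : Prop := w.head? ≠ some (1, 1)

lemma strictAnti_cons {k a : ℕ} {f : Fin k → ℕ} :
    StrictAnti (Fin.cons a f : Fin (k + 1) → ℕ) ↔ (∀ j, f j < a) ∧ StrictAnti f := by
  constructor
  · intro h
    refine ⟨fun j => ?_, fun i j hij => ?_⟩
    · simpa using h (Fin.succ_pos j)
    · simpa using h (Fin.succ_lt_succ_iff.2 hij)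
  · rintro ⟨h1, h2⟩ i j
    refine Fin.cases ?_ (fun i => ?_) i <;> refine Fin.cases ?_ (fun j => ?_) j
    · simp
    · intro _; simpa using h1 j
    · intro h; simp at h
    · intro h; simpa using h2 (Fin.succ_lt_succ_iff.1 h)

/-- Once the largest index is `n + 1`, the others form a chain in `{1, …, n}`; this is why `sumOp`
evaluates its argument at `n` beside a factor in `n + 1`. -/
lemma polylogPartial_succ {k : ℕ} (s : Fin (k + 1) → ℕ) (z : Fin (k + 1) → ℂ) :
    polylogPartial s z = sumOp (s 0) (z 0) (polylogPartial (Fin.tail s) (Fin.tail z)) := by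
  classical
  funext K
  simp only [polylogPartial, sumOp_apply, Finset.mul_sum]
  rw [Finset.sum_sigma']
  refine Finset.sum_bij' (fun n _ => ⟨n 0 - 1, Fin.tail n⟩) (fun x _ => Fin.cons (x.1 + 1) x.2)
    ?_ ?_ ?_ ?_ ?_
  · intro n hn
    simp only [Finset.mem_filter, Fintype.mem_piFinset, Finset.mem_Icc, Finset.mem_sigma,
      Finset.mem_range] at hn ⊢
    obtain ⟨h1, h2⟩ := hn
    have h0 := h1 0
    refine ⟨by omega, fun j => ⟨(h1 j.succ).1, ?_⟩, fun i j hij => ?_⟩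
    · have := h2 (Fin.succ_pos j)
      simp only [Fin.tail]
      omega
    · exact h2 (Fin.succ_lt_succ_iff.2 hij)
  · rintro ⟨m, n⟩ hn
    simp only [Finset.mem_filter, Fintype.mem_piFinset, Finset.mem_Icc, Finset.mem_sigma,
      Finset.mem_range] at hn ⊢
    obtain ⟨h1, h2, h3⟩ := hn
    refine ⟨fun j => ?_, strictAnti_cons.2 ⟨fun j => ?_, h3⟩⟩
    · refine Fin.cases ?_ (fun j => ?_) j
      · simp only [Fin.cons_zero]; omega
      · have := h2 j
        simp only [Fin.cons_succ]; omega
    · have := h2 j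
      omega
  · intro n hn
    simp only [Finset.mem_filter, Fintype.mem_piFinset, Finset.mem_Icc] at hn
    have h0 := (hn.1 0).1
    simp only [Nat.sub_add_cancel h0]
    exact Fin.cons_self_tail n
  · rintro ⟨m, n⟩ hn
    simp
  · intro n hn
    simp only [Finset.mem_filter, Fintype.mem_piFinset, Finset.mem_Icc] at hn
    have h0 := (hn.1 0).1
    rw [Fin.prod_univ_succ]
    have h : ((n 0 - 1 : ℕ) : ℂ) + 1 = n 0 := by
      rw [← Nat.cast_add_one, Nat.sub_add_cancel h0]
    simp only [h, Nat.sub_add_cancel h0]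
    rfl

lemma polylogPartial_zero (s : Fin 0 → ℕ) (z : Fin 0 → ℂ) : polylogPartial s z = 1 := by
  funext K
  simp only [polylogPartial, Finset.univ_eq_empty, Finset.prod_empty, Pi.one_apply]
  rw [Finset.sum_const, Finset.filter_true_of_mem]
  · simp
  · intro n _ i
    exact i.elim0

lemma polylogPartial_eq_nestedSum {k : ℕ} (s : Fin k → ℕ) (z : Fin k → ℂ) :
    polylogPartial s z = nestedSum (List.ofFn fun j => (s j, z j)) := by
  induction k with
  | zero => exact polylogPartial_zero s z
  | succ k ih =>
    rw [polylogPartial_succ, ih, List.ofFn_succ]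
    rfl

lemma isCMZV_of_word {w : List (ℕ × ℂ)} (hv : ValidWord w) (ha : Admissible w) {x : ℂ}
    (hx : Filter.Tendsto (nestedSum w) Filter.atTop (nhds x)) : IsCMZV 4 (wordWeight w) x := by
  have hw : (List.ofFn fun j => (((w.get j).1, (w.get j).2) : ℕ × ℂ)) = w := List.ofFn_get w
  refine ⟨w.length, fun j => (w.get j).1, fun j => (w.get j).2,
    fun j => (hv _ (List.get_mem w j)).1, fun j => (hv _ (List.get_mem w j)).2, ?_, ?_, ?_⟩
  · rw [wordWeight, ← List.sum_ofFn]
    congr 1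
    conv_rhs => rw [← List.ofFn_get w, List.map_ofFn]
    rfl
  · rintro h ⟨h1, h2⟩
    apply ha
    cases w with
    | nil => simp at h
    | cons a w => simpa [Prod.ext_iff] using ⟨h1, h2⟩
  · rw [polylogPartial_eq_nestedSum, hw]
    exact hx

lemma exists_word_of_isCMZV {w : ℕ} {x : ℂ} (h : IsCMZV 4 w x) :
    ∃ l : List (ℕ × ℂ), ValidWord l ∧ Admissible l ∧ wordWeight l = w ∧
      Filter.Tendsto (nestedSum l) Filter.atTop (nhds x) := by
  obtain ⟨k, s, z, h1, h2, h3, h4, h5⟩ := h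
  refine ⟨List.ofFn fun j => (s j, z j), ?_, ?_, ?_, ?_⟩
  · intro a ha
    obtain ⟨j, rfl⟩ := (List.mem_ofFn' _ _).1 ha
    exact ⟨h1 j, h2 j⟩
  · cases k with
    | zero => simp [Admissible]
    | succ k =>
      intro h
      rw [List.ofFn_succ] at h
      simp only [List.head?_cons, Option.some.injEq, Prod.mk.injEq] at h
      exact h4 (Nat.succ_pos k) h
  · rw [wordWeight, List.map_ofFn, List.sum_ofFn, ← h3]
    rfl
  · rw [← polylogPartial_eq_nestedSum]
    exact h5

/-! ### Quasi-shuffle products and the spans of nested sums. -/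

/-- The quasi-shuffle product of two nested sums. -/
lemma sumOp_mul_sumOp (a b : ℕ) (z y : ℂ) (f g : ℕ → ℂ) :
    sumOp a z f * sumOp b y g = sumOp a z (f * sumOp b y g) + sumOp b y (sumOp a z f * g) +
      sumOp (a + b) (z * y) (f * g) := by
  funext N
  induction N with
  | zero => simp [sumOp_zero]
  | succ N ih =>
    simp only [Pi.mul_apply, Pi.add_apply] at ih ⊢
    simp only [sumOp_succ, Pi.mul_apply, add_mul, mul_add, ih, mul_pow, pow_add]
    ring

/-- The span of the nested sums of weight `w`. -/
noncomputable def nestedSpan (w : ℕ) : Submodule ℚ (ℕ → ℂ) :=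
  Submodule.span ℚ {f | ∃ l, ValidWord l ∧ wordWeight l = w ∧ f = nestedSum l}

/-- The span of the admissible nested sums of weight `w`. -/
noncomputable def nestedSpanAdm (w : ℕ) : Submodule ℚ (ℕ → ℂ) :=
  Submodule.span ℚ {f | ∃ l, ValidWord l ∧ Admissible l ∧ wordWeight l = w ∧ f = nestedSum l}

lemma one_mem_nestedSpan : (1 : ℕ → ℂ) ∈ nestedSpan 0 :=
  Submodule.subset_span ⟨[], by simp [ValidWord], by simp [wordWeight], rfl⟩

lemma validWord_cons {a : ℕ × ℂ} {l : List (ℕ × ℂ)} :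
    ValidWord (a :: l) ↔ (1 ≤ a.1 ∧ a.2 ^ 4 = 1) ∧ ValidWord l := by
  simp [ValidWord]

lemma wordWeight_cons (a : ℕ × ℂ) (l : List (ℕ × ℂ)) :
    wordWeight (a :: l) = a.1 + wordWeight l := by
  simp [wordWeight]

lemma sumOp_mem_nestedSpan {k w : ℕ} {z : ℂ} {f : ℕ → ℂ} (hk : 1 ≤ k) (hz : z ^ 4 = 1)
    (hf : f ∈ nestedSpan w) : sumOp k z f ∈ nestedSpan (k + w) := by
  have : nestedSpan w ≤ (nestedSpan (k + w)).comap ((sumOp k z).restrictScalars ℚ) := by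
    refine Submodule.span_le.2 ?_
    rintro f ⟨l, h1, h2, rfl⟩
    exact Submodule.subset_span ⟨(k, z) :: l, validWord_cons.2 ⟨⟨hk, hz⟩, h1⟩,
      by rw [wordWeight_cons, h2], rfl⟩
  exact this hf

lemma sumOp_mem_nestedSpanAdm {k w : ℕ} {z : ℂ} {f : ℕ → ℂ} (hk : 1 ≤ k) (hz : z ^ 4 = 1)
    (hkz : ¬ (k = 1 ∧ z = 1)) (hf : f ∈ nestedSpan w) :
    sumOp k z f ∈ nestedSpanAdm (k + w) := by
  have : nestedSpan w ≤ (nestedSpanAdm (k + w)).comap ((sumOp k z).restrictScalars ℚ) := by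
    refine Submodule.span_le.2 ?_
    rintro f ⟨l, h1, h2, rfl⟩
    exact Submodule.subset_span ⟨(k, z) :: l, validWord_cons.2 ⟨⟨hk, hz⟩, h1⟩,
      by simpa [Admissible] using hkz, by rw [wordWeight_cons, h2], rfl⟩
  exact this hf

lemma nestedSum_mem {l : List (ℕ × ℂ)} (hl : ValidWord l) :
    nestedSum l ∈ nestedSpan (wordWeight l) :=
  Submodule.subset_span ⟨l, hl, rfl, rfl⟩

lemma nestedSum_mul_mem {l l' : List (ℕ × ℂ)} (hl : ValidWord l) (hl' : ValidWord l') :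
    nestedSum l * nestedSum l' ∈ nestedSpan (wordWeight l + wordWeight l') := by
  induction l generalizing l' with
  | nil => simpa [nestedSum, wordWeight] using nestedSum_mem hl'
  | cons a l ih =>
    obtain ⟨⟨ha, haz⟩, hl⟩ := validWord_cons.1 hl
    induction l' with
    | nil => simpa [nestedSum, wordWeight] using nestedSum_mem (validWord_cons.2 ⟨⟨ha, haz⟩, hl⟩)
    | cons b l' ih' =>
      have hbl := hl'
      obtain ⟨⟨hb, hbz⟩, hl'⟩ := validWord_cons.1 hl'
      rw [nestedSum, nestedSum, sumOp_mul_sumOp, wordWeight_cons, wordWeight_cons]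
      refine add_mem (add_mem ?_ ?_) ?_
      · have := sumOp_mem_nestedSpan ha haz (ih hl hbl)
        rwa [wordWeight_cons, ← add_assoc] at this
      · have := sumOp_mem_nestedSpan hb hbz (ih' hl')
        rw [wordWeight_cons, nestedSum] at this
        convert this using 2
        ring
      · have := sumOp_mem_nestedSpan (k := a.1 + b.1) (z := a.2 * b.2) (by omega)
          (by rw [mul_pow, haz, hbz, one_mul]) (ih hl hl')
        convert this using 1
        congr 1
        ring

/-- Of the three quasi-shuffle terms, two begin with the first letter of a factor and the third with
a letter of weight at least 2, so none begins with `(1, 1)`. -/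
lemma nestedSum_mul_mem_adm {l l' : List (ℕ × ℂ)} (hl : ValidWord l) (hl' : ValidWord l')
    (ha : Admissible l) (ha' : Admissible l') :
    nestedSum l * nestedSum l' ∈ nestedSpanAdm (wordWeight l + wordWeight l') := by
  cases l with
  | nil =>
    have h : nestedSum l' ∈ nestedSpanAdm (wordWeight l') :=
      Submodule.subset_span ⟨l', hl', ha', rfl, rfl⟩
    simpa [nestedSum, wordWeight] using h
  | cons a l =>
    cases l' with
    | nil =>
      have h : nestedSum (a :: l) ∈ nestedSpanAdm (wordWeight (a :: l)) :=
        Submodule.subset_span ⟨a :: l, hl, ha, rfl, rfl⟩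
      simpa [nestedSum, wordWeight] using h
    | cons b l' =>
      obtain ⟨⟨h1, h2⟩, h3⟩ := validWord_cons.1 hl
      obtain ⟨⟨h1', h2'⟩, h3'⟩ := validWord_cons.1 hl'
      rw [nestedSum, nestedSum, sumOp_mul_sumOp, wordWeight_cons, wordWeight_cons]
      refine add_mem (add_mem ?_ ?_) ?_
      · have := sumOp_mem_nestedSpanAdm h1 h2 (by simpa [Admissible, Prod.ext_iff] using ha)
          (nestedSum_mul_mem h3 hl')
        rwa [wordWeight_cons, ← add_assoc] at this
      · have := sumOp_mem_nestedSpanAdm h1' h2' (by simpa [Admissible, Prod.ext_iff] using ha')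
          (nestedSum_mul_mem hl h3')
        rw [wordWeight_cons, nestedSum] at this
        convert this using 2
        ring
      · have := sumOp_mem_nestedSpanAdm (k := a.1 + b.1) (z := a.2 * b.2) (by omega)
          (by rw [mul_pow, h2, h2', one_mul]) (by omega) (nestedSum_mul_mem h3 h3')
        convert this using 1
        congr 1
        ring

lemma mul_mem_nestedSpan {a b : ℕ} {f g : ℕ → ℂ} (hf : f ∈ nestedSpan a) (hg : g ∈ nestedSpan b) :
    f * g ∈ nestedSpan (a + b) := by
  have h := Submodule.mul_mem_mul hf hg
  rw [nestedSpan, nestedSpan, Submodule.span_mul_span] at h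
  refine Submodule.span_le.2 ?_ h
  rintro _ ⟨_, ⟨l, h1, rfl, rfl⟩, _, ⟨l', h1', rfl, rfl⟩, rfl⟩
  exact nestedSum_mul_mem h1 h1'

/-! ### Logarithmic growth and convergence of admissible nested sums. -/

/-- One plus the harmonic number `H_N`. -/
noncomputable def harm (N : ℕ) : ℝ := 1 + ∑ n ∈ Finset.range N, 1 / ((n : ℝ) + 1)

lemma harm_succ (N : ℕ) : harm (N + 1) = harm N + 1 / ((N : ℝ) + 1) := by
  simp [harm, Finset.sum_range_succ, add_assoc]

lemma harm_mono : Monotone harm :=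
  monotone_nat_of_le_succ fun n => by
    rw [harm_succ]
    have : (0 : ℝ) ≤ 1 / ((n : ℝ) + 1) := by positivity
    linarith

lemma one_le_harm (N : ℕ) : 1 ≤ harm N := by
  simpa [harm] using harm_mono (Nat.zero_le N)

lemma harm_pos (N : ℕ) : 0 < harm N := zero_lt_one.trans_le (one_le_harm N)

lemma harm_le_log (N : ℕ) : harm N ≤ 2 + Real.log ((N : ℝ) + 1) := by
  have h1 : harm N = 1 + (harmonic N : ℝ) := by
    simp [harm, harmonic]
  have h2 := harmonic_le_one_add_log N
  have h3 : Real.log N ≤ Real.log ((N : ℝ) + 1) := by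
    rcases Nat.eq_zero_or_pos N with rfl | h
    · simp
    · exact Real.log_le_log (by exact_mod_cast h) (by linarith)
  linarith

lemma harm_pow_le (l : ℕ) : ∃ C : ℝ, 0 ≤ C ∧ ∀ N : ℕ,
    harm N ^ l ≤ C * ((N : ℝ) + 1) ^ (1 / 4 : ℝ) := by
  -- With this exponent `ε * l ≤ 1 / 4`, whatever the power `l`.
  set ε : ℝ := 1 / (4 * ((l : ℝ) + 1)) with hε
  have hε0 : 0 < ε := by positivity
  refine ⟨(2 + 1 / ε) ^ l, by positivity, fun N => ?_⟩
  have hN : (1 : ℝ) ≤ (N : ℝ) + 1 := by simp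
  have h1 : harm N ≤ (2 + 1 / ε) * ((N : ℝ) + 1) ^ ε := by
    have h2 := Real.log_le_rpow_div (x := (N : ℝ) + 1) (by positivity) hε0
    have h3 : 1 ≤ ((N : ℝ) + 1) ^ ε := Real.one_le_rpow hN hε0.le
    calc harm N ≤ 2 + Real.log ((N : ℝ) + 1) := harm_le_log N
      _ ≤ 2 * ((N : ℝ) + 1) ^ ε + ((N : ℝ) + 1) ^ ε / ε := by linarith
      _ = _ := by ring
  calc harm N ^ l ≤ ((2 + 1 / ε) * ((N : ℝ) + 1) ^ ε) ^ l :=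
        pow_le_pow_left₀ (harm_pos N).le h1 l
    _ = (2 + 1 / ε) ^ l * ((N : ℝ) + 1) ^ (ε * l) := by
        rw [mul_pow, ← Real.rpow_mul_natCast (by positivity)]
    _ ≤ _ := by
        refine mul_le_mul_of_nonneg_left (Real.rpow_le_rpow_of_exponent_le hN ?_) (by positivity)
        rw [hε, div_mul_eq_mul_div, div_le_div_iff₀ (by positivity) (by norm_num)]
        linarith

/-- The power of the logarithm costs an exponent `1/4`, and `3/2 - 1/4 = 5/4` still exceeds 1. -/
lemma summable_harm_pow (l : ℕ) :
    Summable fun n : ℕ => harm n ^ l / (((n : ℝ) + 1) * √((n : ℝ) + 1)) := by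
  obtain ⟨C, hC, h⟩ := harm_pow_le l
  have hs : Summable fun n : ℕ => C * (1 / |(n : ℝ) + 1| ^ (5 / 4 : ℝ)) :=
    ((Real.summable_one_div_nat_add_rpow 1 (5 / 4)).2 (by norm_num)).mul_left C
  refine Summable.of_nonneg_of_le (fun n => ?_) (fun n => ?_) hs
  · have := (harm_pos n).le
    positivity
  · have hn : (0 : ℝ) < (n : ℝ) + 1 := by positivity
    have h1 : ((n : ℝ) + 1) * √((n : ℝ) + 1) = ((n : ℝ) + 1) ^ (3 / 2 : ℝ) := by
      rw [Real.sqrt_eq_rpow, ← Real.rpow_one_add' hn.le (by norm_num)]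
      norm_num
    have h2 : ((n : ℝ) + 1) ^ (3 / 2 : ℝ) =
        ((n : ℝ) + 1) ^ (5 / 4 : ℝ) * ((n : ℝ) + 1) ^ (1 / 4 : ℝ) := by
      rw [← Real.rpow_add hn]
      norm_num
    rw [h1, h2, abs_of_pos hn, div_le_iff₀ (by positivity)]
    refine (h n).trans_eq ?_
    field_simp

lemma summable_harm_pow_sq (l : ℕ) :
    Summable fun n : ℕ => harm n ^ l / ((n : ℝ) + 1) ^ 2 := by
  refine Summable.of_nonneg_of_le (fun n => ?_) (fun n => ?_) (summable_harm_pow l)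
  · have := (harm_pos n).le
    positivity
  · have := (harm_pos n).le
    have hn : (0 : ℝ) < (n : ℝ) + 1 := by positivity
    refine div_le_div_of_nonneg_left (by positivity) (by positivity) ?_
    rw [sq]
    refine mul_le_mul_of_nonneg_left ?_ hn.le
    rw [Real.sqrt_le_left hn.le]
    nlinarith

lemma tendsto_harm_pow_div (l : ℕ) :
    Filter.Tendsto (fun n : ℕ => harm n ^ l / √((n : ℝ) + 1)) Filter.atTop (nhds 0) := by
  obtain ⟨C, hC, h⟩ := harm_pow_le l
  have ht : Filter.Tendsto (fun n : ℕ => C * ((n : ℝ) + 1) ^ (-(1 / 4) : ℝ)) Filter.atTop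
      (nhds (C * 0)) := by
    refine Filter.Tendsto.const_mul C ?_
    exact (tendsto_rpow_neg_atTop (by norm_num)).comp
      (Filter.tendsto_atTop_add_const_right _ 1 tendsto_natCast_atTop_atTop)
  rw [mul_zero] at ht
  refine squeeze_zero (fun n => ?_) (fun n => ?_) ht
  · have := (harm_pos n).le
    positivity
  · have hn : (0 : ℝ) < (n : ℝ) + 1 := by positivity
    rw [div_le_iff₀ (by positivity), Real.sqrt_eq_rpow, mul_assoc, ← Real.rpow_add hn]
    norm_num
    exact (h n).trans_eq (by norm_num)

lemma norm_eq_one_of_pow_four {z : ℂ} (hz : z ^ 4 = 1) : ‖z‖ = 1 :=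
  Complex.norm_eq_one_of_pow_eq_one hz (by norm_num)

lemma norm_letter {z : ℂ} (hz : z ^ 4 = 1) (n k : ℕ) :
    ‖z ^ (n + 1) / ((n : ℂ) + 1) ^ k‖ = 1 / ((n : ℝ) + 1) ^ k := by
  have : ‖(n : ℂ) + 1‖ = (n : ℝ) + 1 := by
    exact_mod_cast (Complex.norm_natCast (n + 1))
  rw [norm_div, norm_pow, norm_pow, norm_eq_one_of_pow_four hz, this, one_pow]

/-- The growth condition `f(N) = O((1 + H_N) ^ m)` for some `m`. -/
def LogGrowth (f : ℕ → ℂ) : Prop := ∃ (C : ℝ) (m : ℕ), 0 ≤ C ∧ ∀ N, ‖f N‖ ≤ C * harm N ^ m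

lemma LogGrowth.sumOp {f : ℕ → ℂ} (hf : LogGrowth f) {k : ℕ} {z : ℂ} (hk : 1 ≤ k)
    (hz : z ^ 4 = 1) : LogGrowth (sumOp k z f) := by
  obtain ⟨C, m, hC, h⟩ := hf
  refine ⟨C, m + 1, hC, fun N => ?_⟩
  have hN := (harm_pos N).le
  calc ‖_root_.sumOp k z f N‖ ≤ ∑ n ∈ Finset.range N, 1 / ((n : ℝ) + 1) * (C * harm N ^ m) := by
        rw [sumOp_apply]
        refine (norm_sum_le _ _).trans (Finset.sum_le_sum fun n hn => ?_)
        rw [norm_mul, norm_letter hz]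
        have hn' : (1 : ℝ) ≤ (n : ℝ) + 1 := by simp
        refine mul_le_mul ?_ ((h n).trans ?_) (norm_nonneg _) (by positivity)
        · exact div_le_div_of_nonneg_left zero_le_one (by positivity)
            (le_self_pow₀ hn' (by omega))
        · exact mul_le_mul_of_nonneg_left (pow_le_pow_left₀ (harm_pos n).le
            (harm_mono (Finset.mem_range.1 hn).le) m) hC
    _ = (harm N - 1) * (C * harm N ^ m) := by
        rw [← Finset.sum_mul, harm]; ring
    _ ≤ harm N * (C * harm N ^ m) :=
        mul_le_mul_of_nonneg_right (by linarith) (by positivity)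
    _ = _ := by ring

lemma LogGrowth.add {f g : ℕ → ℂ} (hf : LogGrowth f) (hg : LogGrowth g) : LogGrowth (f + g) := by
  obtain ⟨C, m, hC, h⟩ := hf
  obtain ⟨C', m', hC', h'⟩ := hg
  refine ⟨C + C', max m m', by positivity, fun N => ?_⟩
  refine (norm_add_le _ _).trans ?_
  rw [add_mul]
  refine add_le_add ((h N).trans ?_) ((h' N).trans ?_)
  · exact mul_le_mul_of_nonneg_left (pow_le_pow_right₀ (one_le_harm N) (le_max_left _ _)) hC
  · exact mul_le_mul_of_nonneg_left (pow_le_pow_right₀ (one_le_harm N) (le_max_right _ _)) hC'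

lemma LogGrowth.smul {f : ℕ → ℂ} (hf : LogGrowth f) (q : ℚ) : LogGrowth (q • f) := by
  obtain ⟨C, m, hC, h⟩ := hf
  refine ⟨‖(q : ℂ)‖ * C, m, by positivity, fun N => ?_⟩
  rw [Pi.smul_apply, Rat.smul_def, norm_mul, mul_assoc]
  exact mul_le_mul_of_nonneg_left (h N) (norm_nonneg _)

lemma logGrowth_nestedSum {l : List (ℕ × ℂ)} (hl : ValidWord l) : LogGrowth (nestedSum l) := by
  induction l with
  | nil => exact ⟨1, 0, zero_le_one, fun N => by simp [nestedSum]⟩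
  | cons a l ih =>
    obtain ⟨⟨h1, h2⟩, h3⟩ := validWord_cons.1 hl
    exact (ih h3).sumOp h1 h2

lemma logGrowth_of_mem {w : ℕ} {f : ℕ → ℂ} (hf : f ∈ nestedSpan w) : LogGrowth f := by
  refine Submodule.span_induction ?_ ?_ (fun f g _ _ => LogGrowth.add) (fun q f _ h => h.smul q) hf
  · rintro f ⟨l, h1, -, rfl⟩
    exact logGrowth_nestedSum h1
  · exact ⟨0, 0, le_rfl, fun N => by simp⟩

lemma sum_telescope_char (z : ℂ) (g : ℕ → ℂ) (N : ℕ) :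
    (1 - z) * ∑ n ∈ Finset.range N, z ^ (n + 1) * g n =
      z * g 0 - z ^ (N + 1) * g N + ∑ n ∈ Finset.range N, z ^ (n + 2) * (g (n + 1) - g n) := by
  induction N with
  | zero => simp
  | succ N ih =>
    rw [Finset.sum_range_succ, Finset.sum_range_succ, mul_add, ih]
    ring

/-- A version of Dirichlet's test for a nontrivial character of order dividing `4`. -/
lemma exists_tendsto_char {z : ℂ} (hz : z ^ 4 = 1) (hz1 : z ≠ 1) {g : ℕ → ℂ}
    (hg : Filter.Tendsto g Filter.atTop (nhds 0)) (hs : Summable fun n => ‖g (n + 1) - g n‖) :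
    ∃ x, Filter.Tendsto (fun N => ∑ n ∈ Finset.range N, z ^ (n + 1) * g n) Filter.atTop
      (nhds x) := by
  have hsum : Summable fun n => z ^ (n + 2) * (g (n + 1) - g n) := by
    refine Summable.of_norm (hs.congr fun n => ?_)
    rw [norm_mul, norm_pow, norm_eq_one_of_pow_four hz, one_pow, one_mul]
  have h1 : Filter.Tendsto (fun N => z ^ (N + 1) * g N) Filter.atTop (nhds 0) := by
    rw [tendsto_zero_iff_norm_tendsto_zero] at hg ⊢
    refine hg.congr fun n => ?_
    rw [norm_mul, norm_pow, norm_eq_one_of_pow_four hz, one_pow, one_mul]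
  have h2 := ((tendsto_const_nhds (x := z * g 0)).sub h1).add hsum.hasSum.tendsto_sum_nat
  have h3 : 1 - z ≠ 0 := sub_ne_zero.2 (Ne.symm hz1)
  refine ⟨_, (h2.const_mul (1 - z)⁻¹).congr fun N => ?_⟩
  rw [← sum_telescope_char, inv_mul_cancel_left₀ h3]

lemma exists_norm_nestedSum_sub_le {l : List (ℕ × ℂ)} (hl : ValidWord l) :
    ∃ (C : ℝ) (m : ℕ), 0 ≤ C ∧
      ∀ n, ‖nestedSum l (n + 1) - nestedSum l n‖ ≤ C * harm n ^ m / ((n : ℝ) + 1) := by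
  cases l with
  | nil => exact ⟨0, 0, le_rfl, fun n => by simp [nestedSum]⟩
  | cons a l =>
    obtain ⟨⟨hk, hz⟩, h3⟩ := validWord_cons.1 hl
    obtain ⟨C, m, hC, h⟩ := logGrowth_nestedSum h3
    refine ⟨C, m, hC, fun n => ?_⟩
    rw [nestedSum, sumOp_succ, add_sub_cancel_left, norm_mul, norm_letter hz, mul_comm,
      ← mul_div_assoc, mul_one]
    have hn : (1 : ℝ) ≤ (n : ℝ) + 1 := by simp
    have := (harm_pos n).le
    exact div_le_div₀ (by positivity) (h n) (by positivity) (le_self_pow₀ hn (by omega))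

/-- If the first letter has weight at least 2, convergence is absolute. Otherwise its root of unity
is nontrivial, and Dirichlet's test applies because `nestedSum l n / (n + 1)` tends to 0 with
bounded variation. -/
lemma tendsto_nestedSum {l : List (ℕ × ℂ)} (hl : ValidWord l) (ha : Admissible l) :
    ∃ x, Filter.Tendsto (nestedSum l) Filter.atTop (nhds x) := by
  cases l with
  | nil => exact ⟨1, tendsto_const_nhds⟩
  | cons a l =>
    obtain ⟨k, z⟩ := a
    obtain ⟨⟨hk, hz⟩, h3⟩ := validWord_cons.1 hl
    obtain ⟨C, m, hC, h⟩ := logGrowth_nestedSum h3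
    simp only at hk hz
    have hkz : ¬ (k = 1 ∧ z = 1) := by simpa [Admissible] using ha
    rcases hk.eq_or_lt with rfl | hk
    · have hz1 : z ≠ 1 := fun h => hkz ⟨rfl, h⟩
      have key : ∃ x, Filter.Tendsto (fun N => ∑ n ∈ Finset.range N, z ^ (n + 1) *
          (nestedSum l n / ((n : ℂ) + 1))) Filter.atTop (nhds x) := by
        refine exists_tendsto_char hz hz1 ?_ ?_
        · rw [tendsto_zero_iff_norm_tendsto_zero]
          have h0 := (tendsto_harm_pow_div m).const_mul C
          rw [mul_zero] at h0
          refine squeeze_zero (fun n => norm_nonneg _) (fun n => ?_) h0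
          have h1 := norm_letter (z := 1) (by norm_num) n 1
          rw [one_pow, pow_one, pow_one] at h1
          rw [div_eq_mul_one_div, norm_mul, h1, ← mul_div_assoc, ← mul_div_assoc, mul_one]
          have hn : (1 : ℝ) ≤ (n : ℝ) + 1 := by simp
          have := (harm_pos n).le
          refine div_le_div₀ (by positivity) (h n) (by positivity) ?_
          rw [Real.sqrt_le_left (by positivity)]
          nlinarith
        · obtain ⟨C', m', hC', h'⟩ := exists_norm_nestedSum_sub_le h3
          refine Summable.of_nonneg_of_le (fun n => norm_nonneg _) (fun n => ?_)
            (((summable_harm_pow_sq m').mul_left C').add ((summable_harm_pow_sq m).mul_left C))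
          have hn : (0 : ℝ) < (n : ℝ) + 1 := by positivity
          have hc1 : (n : ℂ) + 1 ≠ 0 := Nat.cast_add_one_ne_zero n
          have hc2 : (n : ℂ) + 1 + 1 ≠ 0 := by exact_mod_cast Nat.succ_ne_zero (n + 1)
          have n1 : ‖(n : ℂ) + 1‖ = (n : ℝ) + 1 := by exact_mod_cast Complex.norm_natCast (n + 1)
          have n2 : ‖(n : ℂ) + 1 + 1‖ = (n : ℝ) + 1 + 1 := by
            exact_mod_cast Complex.norm_natCast (n + 1 + 1)
          have e : nestedSum l (n + 1) / (((n + 1 : ℕ) : ℂ) + 1) - nestedSum l n / ((n : ℂ) + 1) =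
              (nestedSum l (n + 1) - nestedSum l n) / ((n : ℂ) + 1 + 1) -
                nestedSum l n / (((n : ℂ) + 1) * ((n : ℂ) + 1 + 1)) := by
            push_cast
            field_simp
            ring
          have := (harm_pos n).le
          rw [e]
          refine (norm_sub_le _ _).trans (add_le_add ?_ ?_)
          · rw [norm_div, n2, ← mul_div_assoc]
            calc _ ≤ (C' * harm n ^ m' / ((n : ℝ) + 1)) / ((n : ℝ) + 1) :=
                  div_le_div₀ (by positivity) (h' n) hn (by linarith)
              _ = _ := by rw [div_div, sq]
          · rw [norm_div, norm_mul, n1, n2, ← mul_div_assoc]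
            refine div_le_div₀ (by positivity) (h n) (by positivity) ?_
            nlinarith
      obtain ⟨x, hx⟩ := key
      refine ⟨x, hx.congr fun N => ?_⟩
      rw [nestedSum, sumOp_apply]
      exact Finset.sum_congr rfl fun n _ => by rw [pow_one]; ring
    · have hs : Summable fun n : ℕ => z ^ (n + 1) / ((n : ℂ) + 1) ^ k * nestedSum l n := by
        refine Summable.of_norm_bounded ((summable_harm_pow_sq m).mul_left C) fun n => ?_
        rw [norm_mul, norm_letter hz, mul_comm, ← mul_div_assoc, ← mul_div_assoc, mul_one]
        have hn : (1 : ℝ) ≤ (n : ℝ) + 1 := by simp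
        have := (harm_pos n).le
        exact div_le_div₀ (by positivity) (h n) (by positivity) (pow_le_pow_right₀ hn hk)
      exact ⟨_, hs.hasSum.tendsto_sum_nat⟩

/-! ### Products of CMZVs, and nested sums with CMZV coefficients. -/

lemma exists_tendsto_of_mem_adm {w : ℕ} {f : ℕ → ℂ} (hf : f ∈ nestedSpanAdm w) :
    ∃ x ∈ cmzv 4 w, Filter.Tendsto f Filter.atTop (nhds x) := by
  refine Submodule.span_induction ?_ ?_ ?_ ?_ hf
  · rintro f ⟨l, h1, h2, rfl, rfl⟩
    obtain ⟨x, hx⟩ := tendsto_nestedSum h1 h2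
    exact ⟨x, Submodule.subset_span (isCMZV_of_word h1 h2 hx), hx⟩
  · exact ⟨0, zero_mem _, tendsto_const_nhds⟩
  · rintro f g - - ⟨x, hx, hx'⟩ ⟨y, hy, hy'⟩
    exact ⟨x + y, add_mem hx hy, hx'.add hy'⟩
  · rintro q f - ⟨x, hx, hx'⟩
    exact ⟨q • x, Submodule.smul_mem _ q hx, hx'.const_smul q⟩

lemma mul_mem_cmzv {a b : ℕ} {x y : ℂ} (hx : x ∈ cmzv 4 a) (hy : y ∈ cmzv 4 b) :
    x * y ∈ cmzv 4 (a + b) := by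
  have h := Submodule.mul_mem_mul hx hy
  rw [cmzv, cmzv, Submodule.span_mul_span] at h
  refine Submodule.span_le.2 ?_ h
  rintro _ ⟨x, hx, y, hy, rfl⟩
  obtain ⟨l, h1, h2, rfl, h4⟩ := exists_word_of_isCMZV hx
  obtain ⟨l', h1', h2', rfl, h4'⟩ := exists_word_of_isCMZV hy
  obtain ⟨z, hz, hz'⟩ := exists_tendsto_of_mem_adm (nestedSum_mul_mem_adm h1 h1' h2 h2')
  have e : x * y = z := tendsto_nhds_unique (h4.mul h4') hz'
  change x * y ∈ cmzv 4 _
  rwa [e]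

lemma one_mem_cmzv : (1 : ℂ) ∈ cmzv 4 0 :=
  Submodule.subset_span
    (isCMZV_of_word (w := []) (by simp [ValidWord]) (by simp [Admissible]) tendsto_const_nhds)

/-- The sequence `n ↦ z ^ (n + 1) / (n + 1) ^ k`. -/
noncomputable def letterSeq (k : ℕ) (z : ℂ) (n : ℕ) : ℂ := z ^ (n + 1) / ((n : ℂ) + 1) ^ k

lemma letterSeq_mul (k k' : ℕ) (z z' : ℂ) :
    letterSeq k z * letterSeq k' z' = letterSeq (k + k') (z * z') := by
  funext n
  simp only [letterSeq, Pi.mul_apply, mul_pow, pow_add]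
  rw [div_mul_div_comm]
  ring

/-- The span of the nested sums with coefficients in the spaces `cmzv 4 a`, of total weight `w`. -/
noncomputable def nestedMod (w : ℕ) : Submodule ℚ (ℕ → ℂ) :=
  Submodule.span ℚ {f | ∃ (a b : ℕ) (c : ℂ) (g : ℕ → ℂ), a + b = w ∧ c ∈ cmzv 4 a ∧
    g ∈ nestedSpan b ∧ f = c • g}

/-- The span of the summands of the elements of `nestedMod w`. -/
noncomputable def summandMod (w : ℕ) : Submodule ℚ (ℕ → ℂ) :=
  Submodule.span ℚ {u | ∃ (k b : ℕ) (z : ℂ) (g : ℕ → ℂ), 1 ≤ k ∧ z ^ 4 = 1 ∧ k + b = w ∧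
    g ∈ nestedMod b ∧ u = letterSeq k z * g}

/-- The series `∑ y n` converges to an element of `cmzv 4 w`. -/
def SumsInCMZV (w : ℕ) (y : ℕ → ℂ) : Prop :=
  ∃ x ∈ cmzv 4 w, Filter.Tendsto (fun N => ∑ n ∈ Finset.range N, y n) Filter.atTop (nhds x)

lemma SumsInCMZV.zero (w : ℕ) : SumsInCMZV w 0 :=
  ⟨0, zero_mem _, by simp⟩

lemma SumsInCMZV.add {w : ℕ} {y y' : ℕ → ℂ} (h : SumsInCMZV w y) (h' : SumsInCMZV w y') :
    SumsInCMZV w (y + y') := by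
  obtain ⟨x, hx, hx'⟩ := h
  obtain ⟨x', hy, hy'⟩ := h'
  exact ⟨x + x', add_mem hx hy, by simpa [Finset.sum_add_distrib] using hx'.add hy'⟩

lemma SumsInCMZV.smul {w : ℕ} {y : ℕ → ℂ} (h : SumsInCMZV w y) (q : ℚ) :
    SumsInCMZV w (q • y) := by
  obtain ⟨x, hx, hx'⟩ := h
  exact ⟨q • x, Submodule.smul_mem _ q hx, by
    simpa [Finset.smul_sum] using hx'.const_smul q⟩

lemma SumsInCMZV.const_mul {v w : ℕ} {c : ℂ} {y : ℕ → ℂ} (hc : c ∈ cmzv 4 v)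
    (h : SumsInCMZV w y) : SumsInCMZV (v + w) (c • y) := by
  obtain ⟨x, hx, hx'⟩ := h
  exact ⟨c * x, mul_mem_cmzv hc hx, by simpa [Finset.mul_sum] using hx'.const_mul c⟩

lemma smul_mem_nestedMod {a b : ℕ} {c : ℂ} {g : ℕ → ℂ} (hc : c ∈ cmzv 4 a)
    (hg : g ∈ nestedSpan b) : c • g ∈ nestedMod (a + b) :=
  Submodule.subset_span ⟨a, b, c, g, rfl, hc, hg, rfl⟩

lemma const_mem_nestedMod {a : ℕ} {c : ℂ} (hc : c ∈ cmzv 4 a) :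
    (fun _ => c) ∈ nestedMod a := by
  have := smul_mem_nestedMod hc one_mem_nestedSpan
  rw [add_zero] at this
  convert this using 1
  funext n
  simp

lemma mul_mem_nestedMod {a b : ℕ} {h g : ℕ → ℂ} (hh : h ∈ nestedSpan a) (hg : g ∈ nestedMod b) :
    h * g ∈ nestedMod (a + b) := by
  have : nestedMod b ≤ (nestedMod (a + b)).comap (LinearMap.mulLeft ℚ h) := by
    refine Submodule.span_le.2 ?_
    rintro _ ⟨v, w, c, g, rfl, hc, hg, rfl⟩
    have h1 := smul_mem_nestedMod hc (mul_mem_nestedSpan hh hg)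
    simp only [SetLike.mem_coe, Submodule.mem_comap, LinearMap.mulLeft_apply, mul_smul_comm]
    convert h1 using 2
    ring
  exact this hg

lemma letterSeq_mul_mem {k b : ℕ} {z : ℂ} {g : ℕ → ℂ} (hk : 1 ≤ k) (hz : z ^ 4 = 1)
    (hg : g ∈ nestedMod b) : letterSeq k z * g ∈ summandMod (k + b) :=
  Submodule.subset_span ⟨k, b, z, g, hk, hz, rfl, hg, rfl⟩

/-- The case `k = 0` is allowed, since the summand already carries a letter of positive weight; it
serves to twist by a character. -/
lemma letterSeq_mul_mem' {k w : ℕ} {z : ℂ} {y : ℕ → ℂ} (hz : z ^ 4 = 1)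
    (hy : y ∈ summandMod w) : letterSeq k z * y ∈ summandMod (k + w) := by
  have : summandMod w ≤ (summandMod (k + w)).comap (LinearMap.mulLeft ℚ (letterSeq k z)) := by
    refine Submodule.span_le.2 ?_
    rintro _ ⟨k', b, z', g, hk', hz', rfl, hg, rfl⟩
    have h1 := letterSeq_mul_mem (k := k + k') (z := z * z') (by omega)
      (by rw [mul_pow, hz, hz', one_mul]) hg
    simp only [SetLike.mem_coe, Submodule.mem_comap, LinearMap.mulLeft_apply]
    rwa [← mul_assoc, letterSeq_mul, ← add_assoc]
  exact this hy

lemma sum_mem_nestedMod {w : ℕ} {y : ℕ → ℂ} (hy : y ∈ summandMod w) :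
    (fun N => ∑ n ∈ Finset.range N, y n) ∈ nestedMod w := by
  refine Submodule.span_induction (p := fun y _ => (fun N => ∑ n ∈ Finset.range N, y n) ∈
    nestedMod w) ?_ ?_ ?_ ?_ hy
  · rintro _ ⟨k, b, z, g, hk, hz, rfl, hg, rfl⟩
    refine Submodule.span_induction (p := fun g _ => (fun N => ∑ n ∈ Finset.range N,
      (letterSeq k z * g) n) ∈ nestedMod (k + b)) ?_ ?_ ?_ ?_ hg
    · rintro _ ⟨v, w, c, g, rfl, hc, hg, rfl⟩
      have h1 := smul_mem_nestedMod hc (sumOp_mem_nestedSpan hk hz hg)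
      rw [show v + (k + w) = k + (v + w) by ring] at h1
      convert h1 using 1
      funext N
      simp only [Pi.smul_apply, sumOp_apply, smul_eq_mul, Pi.mul_apply, letterSeq,
        Finset.mul_sum]
      exact Finset.sum_congr rfl fun n _ => by ring
    · convert zero_mem (nestedMod (k + b)) using 1
      funext N
      simp
    · intro f g _ _ h1 h2
      convert add_mem h1 h2 using 1
      funext N
      simp [mul_add, Finset.sum_add_distrib]
    · intro q f _ h1
      convert Submodule.smul_mem _ q h1 using 1
      funext N
      simp [Finset.smul_sum]
  · convert zero_mem (nestedMod w) using 1
    funext N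
    simp
  · intro f g _ _ h1 h2
    convert add_mem h1 h2 using 1
    funext N
    simp [Finset.sum_add_distrib]
  · intro q f _ h1
    convert Submodule.smul_mem _ q h1 using 1
    funext N
    simp [Finset.smul_sum]

lemma sumsInCMZV_letterSeq_mul {k b : ℕ} {z : ℂ} {g : ℕ → ℂ} (hk : 1 ≤ k) (hz : z ^ 4 = 1)
    (hkz : ¬ (k = 1 ∧ z = 1)) (hg : g ∈ nestedMod b) :
    SumsInCMZV (k + b) (letterSeq k z * g) := by
  refine Submodule.span_induction (p := fun g _ => SumsInCMZV (k + b) (letterSeq k z * g))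
    ?_ ?_ ?_ ?_ hg
  · rintro _ ⟨v, w, c, g, rfl, hc, hg, rfl⟩
    obtain ⟨x, hx, hx'⟩ := exists_tendsto_of_mem_adm (sumOp_mem_nestedSpanAdm hk hz hkz hg)
    have h1 := SumsInCMZV.const_mul hc (y := letterSeq k z * g) ⟨x, hx, hx'⟩
    rw [mul_smul_comm, show k + (v + w) = v + (k + w) by ring]
    exact h1
  · simpa using SumsInCMZV.zero (k + b)
  · intro f g _ _ h1 h2
    simpa [mul_add] using h1.add h2
  · intro q f _ h1
    simpa [mul_smul_comm] using h1.smul q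

/-- Here the letter `(1, 1)` is harmless: it merges with the leading letter of `y` into one of
weight at least 2. -/
lemma sumsInCMZV_letterSeq_mul' {k w m : ℕ} {z : ℂ} {h y : ℕ → ℂ} (hk : 1 ≤ k) (hz : z ^ 4 = 1)
    (hh : h ∈ nestedSpan m) (hy : y ∈ summandMod w) :
    SumsInCMZV (k + m + w) (letterSeq k z * h * y) := by
  refine Submodule.span_induction (p := fun y _ => SumsInCMZV (k + m + w) (letterSeq k z * h * y))
    ?_ ?_ ?_ ?_ hy
  · rintro _ ⟨k', b, z', g, hk', hz', rfl, hg, rfl⟩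
    have h1 := sumsInCMZV_letterSeq_mul (k := k + k') (z := z * z') (by omega)
      (by rw [mul_pow, hz, hz', one_mul]) (by omega) (mul_mem_nestedMod hh hg)
    rw [← letterSeq_mul] at h1
    convert h1 using 1 <;> ring
  · simpa using SumsInCMZV.zero (k + m + w)
  · intro f g _ _ h1 h2
    simpa [mul_add] using h1.add h2
  · intro q f _ h1
    simpa [mul_smul_comm] using h1.smul q

/-! ### Fourier coefficients of powers of the cosine. -/

/-- The coefficient of `exp (iJφ)` in `cos φ ^ N`. -/
noncomputable def cosCoeff : ℕ → ℤ → ℝ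
  | 0, J => if J = 0 then 1 else 0
  | N + 1, J => (cosCoeff N (J - 1) + cosCoeff N (J + 1)) / 2

lemma cosCoeff_succ (N : ℕ) (J : ℤ) :
    cosCoeff (N + 1) J = (cosCoeff N (J - 1) + cosCoeff N (J + 1)) / 2 := rfl

lemma cosCoeff_nonneg (N : ℕ) (J : ℤ) : 0 ≤ cosCoeff N J := by
  induction N generalizing J with
  | zero => rw [cosCoeff]; split_ifs <;> norm_num
  | succ N ih =>
    have := ih (J - 1)
    have := ih (J + 1)
    rw [cosCoeff_succ]
    positivity

lemma cosCoeff_neg (N : ℕ) (J : ℤ) : cosCoeff N (-J) = cosCoeff N J := by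
  induction N generalizing J with
  | zero => simp [cosCoeff]
  | succ N ih =>
    rw [cosCoeff_succ, cosCoeff_succ, ← ih (J - 1), ← ih (J + 1), add_comm]
    congr 3 <;> ring

lemma cosCoeff_eq_zero_of_lt {N : ℕ} {J : ℤ} (h : (N : ℤ) < J) : cosCoeff N J = 0 := by
  induction N generalizing J with
  | zero =>
    rw [cosCoeff, if_neg (by push_cast at h; omega)]
  | succ N ih =>
    push_cast at h
    rw [cosCoeff_succ, ih (by omega), ih (by omega)]
    norm_num

lemma cosCoeff_eq_zero_of_parity {N : ℕ} {J : ℤ} (h : (N : ℤ) % 2 ≠ J % 2) :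
    cosCoeff N J = 0 := by
  induction N generalizing J with
  | zero =>
    rw [cosCoeff, if_neg]
    rintro rfl
    simp at h
  | succ N ih =>
    push_cast at h
    rw [cosCoeff_succ, ih (by omega), ih (by omega)]
    norm_num

/-- This is the derivative of `cos φ ^ (N + 1)`, namely `-(N + 1) cos φ ^ N sin φ`, read on
coefficients. -/
lemma mul_cosCoeff_succ (N : ℕ) (K : ℤ) :
    K * cosCoeff (N + 1) K = (N + 1) * (cosCoeff N (K - 1) - cosCoeff N (K + 1)) / 2 := by
  induction N generalizing K with
  | zero =>
    simp only [cosCoeff]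
    rcases eq_or_ne K 1 with rfl | h1
    · norm_num
    rcases eq_or_ne K (-1) with rfl | h2
    · norm_num
    rw [if_neg (by omega), if_neg (by omega)]
    norm_num
  | succ N ih =>
    have h1 := ih (K - 1)
    have h2 := ih (K + 1)
    have e1 := cosCoeff_succ N (K - 1)
    have e2 := cosCoeff_succ N (K + 1)
    simp only [sub_add_cancel, add_sub_cancel_right] at h1 h2 e1 e2
    rw [cosCoeff_succ (N + 1) K]
    push_cast at h1 h2 ⊢
    linear_combination (1 / 2) * h1 + (1 / 2) * h2 + (-(N : ℝ) / 2 - 1 / 2) * (e1 - e2)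

lemma aperyCoeff_succ (n : ℕ) :
    aperyCoeff (n + 1) = (2 * n + 1) / (2 * (n + 1)) * aperyCoeff n := by
  have h5 : ((n : ℝ) + 1) * (Nat.centralBinom (n + 1) : ℝ) =
      2 * (2 * n + 1) * Nat.centralBinom n := by
    exact_mod_cast Nat.succ_mul_centralBinom_succ n
  have h7 : ((n : ℝ) + 1) ≠ 0 := by positivity
  rw [aperyCoeff, aperyCoeff, pow_succ]
  field_simp
  linear_combination 2 * h5

/-- By symmetry the constant coefficient for `2n + 2` is the coefficient of index 1 for `2n + 1`.
The recurrence and its differentiated form express that number through indices 0 and 2 for `2n`;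
eliminating index 2 gives the recurrence of `aperyCoeff`. -/
lemma cosCoeff_even_zero (n : ℕ) : cosCoeff (2 * n) 0 = aperyCoeff n := by
  induction n with
  | zero => simp [cosCoeff, aperyCoeff]
  | succ n ih =>
    have h1 := mul_cosCoeff_succ (2 * n) 1
    have h2 := cosCoeff_succ (2 * n) 1
    have h3 := cosCoeff_succ (2 * n + 1) 0
    have h4 := cosCoeff_neg (2 * n + 1) 1
    norm_num at h1 h2 h3 h4
    rw [h4] at h3
    rw [ih] at h1 h2
    rw [show 2 * (n + 1) = 2 * n + 1 + 1 by ring, h3]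
    have h7 : ((n : ℝ) + 1) ≠ 0 := by positivity
    rw [aperyCoeff_succ]
    field_simp
    linear_combination h1 + (2 * (n : ℝ) + 1) * h2

lemma aperyCoeff_nonneg (n : ℕ) : 0 ≤ aperyCoeff n := by
  rw [aperyCoeff]; positivity

lemma aperyCoeff_sq_le (n : ℕ) : aperyCoeff n ^ 2 * (2 * n + 1) ≤ 1 := by
  induction n with
  | zero => simp [aperyCoeff]
  | succ n ih =>
    refine le_trans ?_ ih
    have h7 : (0 : ℝ) < (n : ℝ) + 1 := by positivity
    rw [aperyCoeff_succ, mul_pow, div_pow, div_mul_eq_mul_div, div_mul_eq_mul_div,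
      div_le_iff₀ (by positivity)]
    have h8 : 0 ≤ aperyCoeff n ^ 2 * (2 * n + 1) := by positivity
    push_cast
    nlinarith

/-- Since the left side of `mul_cosCoeff_succ` is nonnegative for a nonnegative index, coefficients
decrease in steps of two away from the centre. -/
lemma cosCoeff_le_base (N j : ℕ) : cosCoeff N j ≤ max (cosCoeff N 0) (cosCoeff N 1) := by
  induction j using Nat.strong_induction_on with
  | _ j ih =>
    rcases j with _ | _ | j
    · simp
    · simp
    · refine le_trans ?_ (ih j (by omega))
      have h1 := mul_cosCoeff_succ N (j + 1)
      have h2 := cosCoeff_nonneg (N + 1) (j + 1)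
      have h3 : (0 : ℝ) ≤ ((j + 1 : ℤ) : ℝ) * cosCoeff (N + 1) (j + 1) := by
        push_cast; positivity
      rw [h1] at h3
      have h4 : 0 ≤ cosCoeff N ((j : ℤ) + 1 - 1) - cosCoeff N ((j : ℤ) + 1 + 1) := by
        by_contra hneg
        have : (0 : ℝ) < (N : ℝ) + 1 := by positivity
        push Not at hneg
        nlinarith
      rw [add_sub_cancel_right] at h4
      push_cast
      rw [show (j : ℤ) + 1 + 1 = j + 1 + 1 by ring] at h4 ⊢
      linarith

lemma cosCoeff_le (N j : ℕ) : cosCoeff N j ≤ 1 / √((N : ℝ) + 1) := by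
  refine (cosCoeff_le_base N j).trans ?_
  have key : ∀ x : ℝ, 0 ≤ x → x ^ 2 * (N + 1) ≤ 1 → x ≤ 1 / √((N : ℝ) + 1) := by
    intro x hx h
    rw [le_div_iff₀ (by positivity), ← Real.sqrt_sq hx, ← Real.sqrt_mul (by positivity),
      Real.sqrt_le_left zero_le_one, one_pow]
    exact h
  rcases Nat.even_or_odd' N with ⟨n, rfl | rfl⟩
  · refine max_le (key _ (cosCoeff_nonneg _ _) ?_) ?_
    · rw [cosCoeff_even_zero]
      exact_mod_cast aperyCoeff_sq_le n
    · rw [cosCoeff_eq_zero_of_parity (by push_cast; omega)]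
      positivity
  · refine max_le ?_ (key _ (cosCoeff_nonneg _ _) ?_)
    · rw [cosCoeff_eq_zero_of_parity (by push_cast; omega)]
      positivity
    · have h3 := cosCoeff_succ (2 * n + 1) 0
      have h4 := cosCoeff_neg (2 * n + 1) 1
      norm_num at h3 h4
      have h5 : cosCoeff (2 * n + 1) 1 = aperyCoeff (n + 1) := by
        rw [← cosCoeff_even_zero, show 2 * (n + 1) = 2 * n + 1 + 1 by ring, h3, h4]
        ring
      rw [h5]
      refine le_trans ?_ (aperyCoeff_sq_le (n + 1))
      refine mul_le_mul_of_nonneg_left ?_ (sq_nonneg _)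
      push_cast
      linarith

lemma cosCoeff_le' (N : ℕ) (J : ℤ) : cosCoeff N J ≤ 1 / √((N : ℝ) + 1) := by
  rcases Int.eq_nat_or_neg J with ⟨j, rfl | rfl⟩
  · exact cosCoeff_le N j
  · rw [cosCoeff_neg]
    exact cosCoeff_le N j

/-- The symmetric sum of the coefficients of index at most `k + 1` in absolute value, those of
index `± (k + 1)` with weight one half. -/
noncomputable def cosCoeffSum (k N : ℕ) : ℝ :=
  cosCoeff N ((k : ℤ) + 1) + 2 * ∑ j ∈ Finset.range k, cosCoeff N ((j : ℤ) + 1) + cosCoeff N 0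

/-- With `K = k + 1`, `cosCoeffSum k N` pairs `cos φ ^ N` with the kernel `sin(Kφ) cot(φ/2)`. As `(1
- cos φ) cot(φ/2) = sin φ`, the difference pairs `cos φ ^ N sin φ` with `sin(Kφ)`, and integration
by parts gives the right side. -/
lemma cosCoeffSum_sub (k N : ℕ) :
    cosCoeffSum k N - cosCoeffSum k (N + 1) =
      (k + 1) * cosCoeff (N + 1) ((k : ℤ) + 1) / (N + 1) := by
  have hN : (N : ℝ) + 1 ≠ 0 := by positivity
  have h := mul_cosCoeff_succ N ((k : ℤ) + 1)
  push_cast at h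
  rw [h]
  have e : ((N : ℝ) + 1) * (cosCoeff N ((k : ℤ) + 1 - 1) - cosCoeff N ((k : ℤ) + 1 + 1)) / 2 /
      (N + 1) = (cosCoeff N k - cosCoeff N ((k : ℤ) + 1 + 1)) / 2 := by
    rw [add_sub_cancel_right]
    field_simp
  rw [e]
  clear h e
  induction k with
  | zero =>
    have h1 := cosCoeff_succ N 1
    have h2 := cosCoeff_succ N 0
    have h3 := cosCoeff_neg N 1
    norm_num at h1 h2 h3
    simp [cosCoeffSum]
    rw [h1, h2, h3]
    ring
  | succ k ih =>
    have h1 := cosCoeff_succ N ((k : ℤ) + 1)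
    have h2 := cosCoeff_succ N ((k : ℤ) + 1 + 1)
    rw [add_sub_cancel_right] at h1 h2
    simp only [cosCoeffSum, Finset.sum_range_succ] at ih ⊢
    push_cast
    linear_combination ih - h1 - h2

/-! ### Cosine coefficients of power series in `cos φ`. -/

/-- The sequence is nonnegative and `O((1 + H_N) ^ m / N)` for some `m`. -/
def LogBound (γ : ℕ → ℝ) : Prop :=
  ∃ (C : ℝ) (m : ℕ), 0 ≤ C ∧ ∀ N, 0 ≤ γ N ∧ γ N ≤ C * harm N ^ m / ((N : ℝ) + 1)

/-- The coefficient of `exp (iJφ)` in `∑ γ_N cos φ ^ N`. -/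
noncomputable def cosTransform (γ : ℕ → ℝ) (J : ℤ) : ℝ := ∑' N, γ N * cosCoeff N J

lemma LogBound.summable_bound {γ : ℕ → ℝ} (h : LogBound γ) (l : ℕ) :
    Summable fun N : ℕ => harm N ^ l * (γ N * (1 / √((N : ℝ) + 1))) := by
  obtain ⟨C, m, hC, h⟩ := h
  refine Summable.of_nonneg_of_le (fun N => ?_) (fun N => ?_)
    ((summable_harm_pow (l + m)).mul_left C)
  · have := (h N).1
    have := (harm_pos N).le
    positivity
  · have := (harm_pos N).le
    calc harm N ^ l * (γ N * (1 / √((N : ℝ) + 1)))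
        ≤ harm N ^ l * (C * harm N ^ m / ((N : ℝ) + 1) * (1 / √((N : ℝ) + 1))) := by
          refine mul_le_mul_of_nonneg_left ?_ (by positivity)
          exact mul_le_mul_of_nonneg_right (h N).2 (by positivity)
      _ = _ := by
          rw [pow_add]
          field_simp

lemma LogBound.summable {γ : ℕ → ℝ} (h : LogBound γ) (J : ℤ) :
    Summable fun N => γ N * cosCoeff N J := by
  refine Summable.of_nonneg_of_le (fun N => ?_) (fun N => ?_) (h.summable_bound 0)
  · obtain ⟨C, m, hC, h⟩ := h
    exact mul_nonneg (h N).1 (cosCoeff_nonneg N J)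
  · obtain ⟨C, m, hC, h⟩ := h
    rw [pow_zero, one_mul]
    exact mul_le_mul_of_nonneg_left (cosCoeff_le' N J) (h N).1

/-- The coefficients decay faster than any power of the logarithm grows, by dominated convergence:
each term vanishes once `T > N`, and for `T ≤ N` the factor `harm T` is at most `harm N`. -/
lemma LogBound.tendsto {γ : ℕ → ℝ} (h : LogBound γ) (l : ℕ) :
    Filter.Tendsto (fun T : ℕ => harm T ^ l * cosTransform γ T) Filter.atTop (nhds 0) := by
  have key : Filter.Tendsto (fun T : ℕ => ∑' N, harm T ^ l * (γ N * cosCoeff N T)) Filter.atTop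
      (nhds (∑' _ : ℕ, (0 : ℝ))) := by
    refine tendsto_tsum_of_dominated_convergence (h.summable_bound l) (fun N => ?_) ?_
    · refine tendsto_const_nhds.congr' ?_
      filter_upwards [Filter.eventually_gt_atTop N] with T hT
      rw [cosCoeff_eq_zero_of_lt (by exact_mod_cast hT), mul_zero, mul_zero]
    · refine Filter.Eventually.of_forall fun T N => ?_
      obtain ⟨C, m, hC, h⟩ := h
      have h1 := (harm_pos T).le
      have h1' := (harm_pos N).le
      have h2 := cosCoeff_nonneg N T
      have h3 := (h N).1
      rw [Real.norm_of_nonneg (by positivity)]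
      rcases lt_or_ge N T with hT | hT
      · rw [cosCoeff_eq_zero_of_lt (by exact_mod_cast hT), mul_zero, mul_zero]
        positivity
      · exact mul_le_mul (pow_le_pow_left₀ h1 (harm_mono hT) l)
          (mul_le_mul_of_nonneg_left (cosCoeff_le N T) h3) (by positivity) (by positivity)
  rw [tsum_zero] at key
  exact key.congr fun T => tsum_mul_left

lemma LogBound.cosTransform_nonneg {γ : ℕ → ℝ} (h : LogBound γ) (J : ℤ) :
    0 ≤ cosTransform γ J := by
  obtain ⟨C, m, hC, h⟩ := h
  exact tsum_nonneg fun N => mul_nonneg (h N).1 (cosCoeff_nonneg N J)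

lemma LogBound.tendsto_succ {γ : ℕ → ℝ} (h : LogBound γ) (l : ℕ) :
    Filter.Tendsto (fun T : ℕ => harm T ^ l * cosTransform γ ((T : ℤ) + 1)) Filter.atTop
      (nhds 0) := by
  refine squeeze_zero (fun T => ?_) (fun T => ?_)
    ((h.tendsto l).comp (Filter.tendsto_add_atTop_nat 1))
  · have := (harm_pos T).le
    have := h.cosTransform_nonneg ((T : ℤ) + 1)
    positivity
  · simp only [Function.comp_apply, Nat.cast_add, Nat.cast_one]
    refine mul_le_mul_of_nonneg_right ?_ (h.cosTransform_nonneg _)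
    exact pow_le_pow_left₀ (harm_pos T).le (harm_mono (Nat.le_succ T)) l

lemma LogBound.shift {γ : ℕ → ℝ} (h : LogBound γ) : LogBound fun N => γ (N + 1) := by
  obtain ⟨C, m, hC, h⟩ := h
  refine ⟨C * 2 ^ m, m, by positivity, fun N => ⟨(h _).1, (h _).2.trans ?_⟩⟩
  have h1 := one_le_harm N
  have h2 : harm (N + 1) ≤ 2 * harm N := by
    have : 1 / ((N : ℝ) + 1) ≤ 1 := by
      rw [div_le_one (by positivity)]
      simp
    rw [harm_succ]
    linarith
  rw [mul_assoc, ← mul_pow]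
  have := (harm_pos (N + 1)).le
  refine div_le_div₀ (by positivity) ?_ (by positivity) (by push_cast; linarith)
  exact mul_le_mul_of_nonneg_left (pow_le_pow_left₀ this h2 m) hC

/-- If `γ 0 = 0`, the transform of `γ` is determined by that of the shifted sequence. -/
lemma LogBound.cosTransform_shift {γ : ℕ → ℝ} (h : LogBound γ) (h0 : γ 0 = 0) (J : ℤ) :
    cosTransform γ J = (cosTransform (fun N => γ (N + 1)) (J - 1) +
      cosTransform (fun N => γ (N + 1)) (J + 1)) / 2 := by
  rw [cosTransform, (h.summable J).tsum_eq_zero_add, h0, zero_mul, zero_add, cosTransform,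
    cosTransform, ← (h.shift.summable _).tsum_add (h.shift.summable _), ← tsum_div_const]
  exact tsum_congr fun N => by rw [cosCoeff_succ]; ring

/-- This is integration against `dx/x`: the `φ`-derivative of `∑ γ_N cos φ ^ N / N` is `-sin φ`
times the shifted series. The term `N = 0` drops out because division by zero gives 0. -/
lemma LogBound.cosTransform_div {γ : ℕ → ℝ} (h : LogBound γ) (J : ℤ) :
    J * cosTransform (fun N => γ N / N) J = (cosTransform (fun N => γ (N + 1)) (J - 1) -
      cosTransform (fun N => γ (N + 1)) (J + 1)) / 2 := by
  have e : ∀ N : ℕ, J * (γ (N + 1) / ((N + 1 : ℕ) : ℝ) * cosCoeff (N + 1) J) =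
      (γ (N + 1) * cosCoeff N (J - 1) - γ (N + 1) * cosCoeff N (J + 1)) / 2 := fun N => by
    have hN : (N : ℝ) + 1 ≠ 0 := by positivity
    have h1 := mul_cosCoeff_succ N J
    push_cast
    field_simp
    linear_combination 2 * γ (N + 1) * h1
  rw [cosTransform, cosTransform, cosTransform,
    ← (h.shift.summable _).tsum_sub (h.shift.summable _), ← tsum_div_const, ← tsum_mul_left]
  have hs : Summable fun N : ℕ => J * (γ N / N * cosCoeff N J) := by
    rw [← summable_nat_add_iff 1]
    simp only [e]
    exact ((h.shift.summable _).sub (h.shift.summable _)).div_const 2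
  rw [hs.tsum_eq_zero_add]
  simp only [e, Nat.cast_zero, div_zero, zero_mul, mul_zero, zero_add]

lemma cosTransform_eq_zero {γ : ℕ → ℝ} {p : ℕ} (h : ∀ N, N % 2 ≠ p → γ N = 0)
    {J : ℤ} (hJ : J % 2 ≠ p) : cosTransform γ J = 0 := by
  rw [cosTransform, ← tsum_zero (α := ℝ) (β := ℕ)]
  refine tsum_congr fun N => ?_
  by_cases hN : N % 2 = p
  · rw [cosCoeff_eq_zero_of_parity (by omega), mul_zero]
  · rw [h N hN, zero_mul]

lemma sum_cosCoeffSum (γ : ℕ → ℝ) (k T : ℕ) :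
    ∑ N ∈ Finset.range T, (cosCoeffSum k N - cosCoeffSum k (N + 1)) *
        ∑ M ∈ Finset.range (N + 1), γ M =
      ∑ M ∈ Finset.range T, γ M * cosCoeffSum k M -
        cosCoeffSum k T * ∑ M ∈ Finset.range T, γ M := by
  induction T with
  | zero => simp
  | succ T ih =>
    rw [Finset.sum_range_succ, ih, Finset.sum_range_succ _ T, Finset.sum_range_succ _ T]
    ring

lemma cosCoeffSum_nonneg (k N : ℕ) : 0 ≤ cosCoeffSum k N :=
  add_nonneg (add_nonneg (cosCoeff_nonneg _ _)
    (mul_nonneg zero_le_two (Finset.sum_nonneg fun _ _ => cosCoeff_nonneg _ _)))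
    (cosCoeff_nonneg _ _)

lemma cosCoeffSum_le (k N : ℕ) : cosCoeffSum k N ≤ (2 * k + 2) * (1 / √((N : ℝ) + 1)) := by
  have h1 : ∑ j ∈ Finset.range k, cosCoeff N ((j : ℤ) + 1) ≤ k * (1 / √((N : ℝ) + 1)) := by
    calc ∑ j ∈ Finset.range k, cosCoeff N ((j : ℤ) + 1)
        ≤ ∑ j ∈ Finset.range k, 1 / √((N : ℝ) + 1) :=
          Finset.sum_le_sum fun j _ => cosCoeff_le' N _
      _ = _ := by simp
  have h2 := cosCoeff_le' N ((k : ℤ) + 1)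
  have h3 := cosCoeff_le' N 0
  rw [cosCoeffSum]
  linarith

/-- Summation by parts in `N`: the partial sums of `γ` are paired with the differences computed in
`cosCoeffSum_sub`. -/
lemma LogBound.cosTransform_sum {γ γ' : ℕ → ℝ} (h : LogBound γ) (h' : LogBound γ') {q m : ℕ}
    (hq : q < 2) (hb : ∀ N, ∑ M ∈ Finset.range N, γ M ≤ harm N ^ m)
    (e : ∀ N, γ' N = if N % 2 = q then (∑ M ∈ Finset.range N, γ M) / N else 0) (k : ℕ)
    (hk : (k + 1) % 2 = q) :
    (k + 1) * cosTransform γ' ((k : ℤ) + 1) = cosTransform γ ((k : ℤ) + 1) +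
      2 * ∑ j ∈ Finset.range k, cosTransform γ ((j : ℤ) + 1) + cosTransform γ 0 := by
  have hs : HasSum (fun M => γ M * cosCoeffSum k M) (cosTransform γ ((k : ℤ) + 1) +
      2 * ∑ j ∈ Finset.range k, cosTransform γ ((j : ℤ) + 1) + cosTransform γ 0) := by
    have h0 : HasSum (fun M => ∑ j ∈ Finset.range k, γ M * cosCoeff M ((j : ℤ) + 1))
        (∑ j ∈ Finset.range k, cosTransform γ ((j : ℤ) + 1)) :=
      hasSum_sum (f := fun j M => γ M * cosCoeff M (((j : ℕ) : ℤ) + 1))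
        fun j _ => (h.summable ((j : ℤ) + 1)).hasSum
    have h1 := h0.mul_left 2
    have h2 := ((h.summable ((k : ℤ) + 1)).hasSum.add h1).add (h.summable 0).hasSum
    have e2 : (fun M => γ M * cosCoeffSum k M) = fun M => γ M * cosCoeff M ((k : ℤ) + 1) +
        2 * ∑ j ∈ Finset.range k, γ M * cosCoeff M ((j : ℤ) + 1) + γ M * cosCoeff M 0 := by
      funext M
      rw [cosCoeffSum, ← Finset.mul_sum]
      ring
    rw [e2]
    exact h2
  -- The boundary term is at most a power of the logarithm divided by `√T`.
  have h0 : Filter.Tendsto (fun T => cosCoeffSum k T * ∑ M ∈ Finset.range T, γ M) Filter.atTop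
      (nhds 0) := by
    have ht := (tendsto_harm_pow_div m).const_mul (2 * (k : ℝ) + 2)
    rw [mul_zero] at ht
    have hγ : ∀ N, 0 ≤ γ N := by
      obtain ⟨C, m, hC, h⟩ := h
      exact fun N => (h N).1
    refine squeeze_zero (fun T => mul_nonneg (cosCoeffSum_nonneg k T)
      (Finset.sum_nonneg fun M _ => hγ M)) (fun T => ?_) ht
    refine (mul_le_mul (cosCoeffSum_le k T) (hb T) (Finset.sum_nonneg fun M _ => hγ M)
      (by positivity)).trans_eq ?_
    ring
  have h1 := hs.tendsto_sum_nat.sub h0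
  rw [sub_zero] at h1
  have h2 : HasSum (fun N => γ' (N + 1) * cosCoeff (N + 1) ((k : ℤ) + 1))
      (cosTransform γ' ((k : ℤ) + 1)) := by
    have h3 := (h'.summable ((k : ℤ) + 1)).hasSum
    rw [← hasSum_nat_add_iff' 1] at h3
    simpa [e 0, cosTransform] using h3
  refine tendsto_nhds_unique (h2.mul_left ((k : ℝ) + 1)).tendsto_sum_nat (h1.congr fun T => ?_)
  rw [← sum_cosCoeffSum]
  refine Finset.sum_congr rfl fun N _ => ?_
  rw [cosCoeffSum_sub, e]
  split_ifs with hN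
  · push_cast
    ring
  -- Exponents of the parity discarded by `γ'` contribute nothing to an index of parity `q`.
  · rw [cosCoeff_eq_zero_of_parity (by push_cast; omega)]
    ring

lemma sum_le_harm_pow {γ : ℕ → ℝ} {w : ℕ} (h0 : γ 0 ≤ 1)
    (h : ∀ N : ℕ, (N : ℝ) * γ N ≤ harm N ^ w) (N : ℕ) :
    ∑ M ∈ Finset.range N, γ M ≤ harm N ^ (w + 1) := by
  rcases N with _ | N
  · simpa using pow_nonneg (harm_pos 0).le _
  have hp := (harm_pos (N + 1)).le
  have h1 := one_le_harm (N + 1)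
  rw [Finset.sum_range_succ']
  calc ∑ M ∈ Finset.range N, γ (M + 1) + γ 0
      ≤ ∑ M ∈ Finset.range N, 1 / ((M : ℝ) + 1) * harm (N + 1) ^ w + 1 * harm (N + 1) ^ w := by
        refine add_le_add (Finset.sum_le_sum fun M hM => ?_) ?_
        · have h2 := h (M + 1)
          rw [div_mul_eq_mul_div, one_mul, le_div_iff₀ (by positivity), mul_comm]
          push_cast at h2
          refine h2.trans (pow_le_pow_left₀ (harm_pos _).le (harm_mono ?_) w)
          have := Finset.mem_range.1 hM
          omega
        · rw [one_mul]
          exact h0.trans (one_le_pow₀ h1)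
    _ = harm N * harm (N + 1) ^ w := by
        rw [← Finset.sum_mul, ← add_mul, add_comm]; rfl
    _ ≤ harm (N + 1) * harm (N + 1) ^ w :=
        mul_le_mul_of_nonneg_right (harm_mono (Nat.le_succ N)) (by positivity)
    _ = _ := by ring

/-! ### Taylor coefficients of the iterated integrals, and their growth. -/

/-- The coefficient sequences, in powers of `x`, of the iterated integrals in the forms `dx / x`,
`x dx / (1 - x²)` and `dx / (1 - x²)`; they are indexed by the parity of the powers of `x` that
occur, and by the weight. -/
inductive AperySeq : ℕ → ℕ → (ℕ → ℚ) → Prop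
  | one : AperySeq 0 0 (Pi.single 0 1)
  | div {p w : ℕ} {β : ℕ → ℚ} : AperySeq p (w + 1) β → AperySeq p (w + 2) (fun N => β N / N)
  | sum {p w : ℕ} {β : ℕ → ℚ} (q : ℕ) : q < 2 → AperySeq p w β →
      AperySeq q (w + 1) (fun N => if N % 2 = q then (∑ M ∈ Finset.range N, β M) / N else 0)

namespace AperySeq

variable {p w : ℕ} {β : ℕ → ℚ}

lemma parity_lt (h : AperySeq p w β) : p < 2 := by
  induction h with
  | one => norm_num
  | div _ ih => exact ih
  | sum q hq _ _ => exact hq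

lemma nonneg (h : AperySeq p w β) (N : ℕ) : 0 ≤ β N := by
  induction h generalizing N with
  | one => by_cases hN : N = 0 <;> simp [hN]
  | div _ ih => exact div_nonneg (ih N) (Nat.cast_nonneg N)
  | sum q hq _ ih =>
    dsimp only
    split_ifs
    · exact div_nonneg (Finset.sum_nonneg fun M _ => ih M) (Nat.cast_nonneg N)
    · exact le_rfl

lemma eq_zero_of_parity (h : AperySeq p w β) {N : ℕ} (hN : N % 2 ≠ p) : β N = 0 := by
  induction h with
  | one =>
    rw [Pi.single_apply, if_neg]
    rintro rfl
    exact hN rfl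
  | div _ ih => simp [ih hN]
  | sum q hq _ _ => exact if_neg hN

lemma apply_zero (h : AperySeq p (w + 1) β) : β 0 = 0 := by
  cases h <;> simp

lemma apply_zero_le (h : AperySeq p w β) : β 0 ≤ 1 := by
  cases h <;> simp

lemma mul_le (h : AperySeq p w β) (N : ℕ) : (N : ℝ) * β N ≤ harm N ^ w := by
  induction h generalizing N with
  | one =>
    rcases eq_or_ne N 0 with rfl | h
    · simp
    · simp [h]
  | @div p w β hb ih =>
    rcases N with _ | N
    · simpa using pow_nonneg (harm_pos 0).le _
    have h1 := one_le_harm (N + 1)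
    have h2 : (0 : ℝ) ≤ β (N + 1) := by exact_mod_cast hb.nonneg (N + 1)
    have h3 := ih (N + 1)
    push_cast at h3 ⊢
    have hN : (0 : ℝ) < (N : ℝ) + 1 := by positivity
    rw [mul_div_cancel₀ _ hN.ne']
    calc (β (N + 1) : ℝ) ≤ ((N : ℝ) + 1) * β (N + 1) := by nlinarith
      _ ≤ _ := h3.trans (pow_le_pow_right₀ h1 (Nat.le_succ _))
  | @sum p w β q hq hb ih =>
    have h1 := sum_le_harm_pow (γ := fun N => (β N : ℝ)) (by exact_mod_cast hb.apply_zero_le) ih N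
    rcases N with _ | N
    · simpa using pow_nonneg (harm_pos 0).le _
    have hN : ((N + 1 : ℕ) : ℝ) ≠ 0 := by positivity
    dsimp only
    split_ifs
    · rw [Rat.cast_div, Rat.cast_natCast, mul_div_cancel₀ _ hN, Rat.cast_sum]
      exact h1
    · simpa using pow_nonneg (harm_pos (N + 1)).le _

lemma sum_le (h : AperySeq p w β) (N : ℕ) :
    ∑ M ∈ Finset.range N, (β M : ℝ) ≤ harm N ^ (w + 1) :=
  sum_le_harm_pow (γ := fun N => (β N : ℝ)) (by exact_mod_cast h.apply_zero_le) h.mul_le N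

lemma logBound (h : AperySeq p w β) : LogBound fun N => (β N : ℝ) := by
  refine ⟨2, w, zero_le_two, fun N => ⟨Rat.cast_nonneg.2 (h.nonneg N), ?_⟩⟩
  dsimp only
  rw [le_div_iff₀ (by positivity)]
  have h1 := h.mul_le N
  have h2 : (1 : ℝ) ≤ harm N ^ w := one_le_pow₀ (one_le_harm N)
  rcases N with _ | N
  · have h0 : (β 0 : ℝ) ≤ 1 := by exact_mod_cast h.apply_zero_le
    push_cast
    linarith
  · have h3 : (0 : ℝ) ≤ β (N + 1) := by exact_mod_cast h.nonneg (N + 1)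
    push_cast at h1 ⊢
    nlinarith

end AperySeq

/-! ### Parity projections and a summation by parts. -/

/-- The parity condition is the average of the two characters of order dividing 2, hence stays
inside level 4. -/
lemma ite_parity {q : ℕ} (hq : q < 2) (n : ℕ) (a : ℂ) :
    (if (n + 1) % 2 = q then a else 0) =
      (1 / 2 : ℚ) • (a + ((-1 : ℚ) ^ q) • ((-1) ^ (n + 1) * a)) := by
  have hn : ((-1 : ℂ) ^ (n + 1) = if (n + 1) % 2 = 0 then 1 else -1) := by
    split_ifs with h
    · exact (Nat.even_iff.2 h).neg_one_pow
    · exact (Nat.odd_iff.2 (by omega)).neg_one_pow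
  rw [hn]
  have : (n + 1) % 2 < 2 := Nat.mod_lt _ two_pos
  interval_cases q <;> interval_cases (n + 1) % 2 <;> simp [Rat.smul_def] <;> ring

lemma ite_parity_mem_summandMod {w q : ℕ} (hq : q < 2) {y : ℕ → ℂ} (hy : y ∈ summandMod w) :
    (fun n => if (n + 1) % 2 = q then y n else 0) ∈ summandMod w := by
  have h1 := letterSeq_mul_mem' (k := 0) (z := -1) (by norm_num) hy
  rw [zero_add] at h1
  convert Submodule.smul_mem _ (1 / 2 : ℚ) (add_mem hy (Submodule.smul_mem _ ((-1 : ℚ) ^ q) h1))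
    using 1
  funext n
  rw [ite_parity hq]
  simp [letterSeq]

lemma sum_ite_parity_mem_nestedSpan {k m q : ℕ} (hk : 1 ≤ k) (hq : q < 2) {h : ℕ → ℂ}
    (hh : h ∈ nestedSpan m) :
    (fun N => ∑ n ∈ Finset.range N, if (n + 1) % 2 = q then letterSeq k 1 n * h n else 0) ∈
      nestedSpan (k + m) := by
  have h1 := sumOp_mem_nestedSpan (z := 1) hk (by norm_num) hh
  have h2 := sumOp_mem_nestedSpan (z := -1) hk (by norm_num) hh
  convert Submodule.smul_mem _ (1 / 2 : ℚ) (add_mem h1 (Submodule.smul_mem _ ((-1 : ℚ) ^ q) h2))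
    using 1
  funext N
  simp only [Pi.smul_apply, Pi.add_apply, sumOp_apply, Finset.smul_sum, ← Finset.sum_add_distrib]
  refine Finset.sum_congr rfl fun n _ => ?_
  rw [ite_parity hq]
  congr 3
  simp [letterSeq]
  ring

lemma SumsInCMZV.ite_parity {w q : ℕ} (hq : q < 2) {y : ℕ → ℂ} (h : SumsInCMZV w y)
    (h' : SumsInCMZV w (letterSeq 0 (-1) * y)) :
    SumsInCMZV w fun n => if (n + 1) % 2 = q then y n else 0 := by
  convert (h.add (h'.smul ((-1) ^ q))).smul (1 / 2) using 1
  funext n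
  rw [_root_.ite_parity hq]
  simp [letterSeq]

/-- For `κ` the limit of `∑ 2 * ξ j`, the boundary term vanishes in the limit under a growth
condition on `∑ d k`; what remains is a sum of `ξ` against the trapezoidal sums of `d`. -/
lemma sum_abel (d ξ : ℕ → ℂ) (κ : ℂ) (T : ℕ) :
    ∑ k ∈ Finset.range T, d k * (κ - (∑ j ∈ Finset.range k, 2 * ξ j +
        ∑ j ∈ Finset.range (k + 1), 2 * ξ j) / 2) =
      (∑ k ∈ Finset.range T, d k) * (κ - ∑ j ∈ Finset.range T, 2 * ξ j) +
        ∑ k ∈ Finset.range T, ξ k * (2 * ∑ j ∈ Finset.range k, d j + d k) := by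
  induction T with
  | zero => simp
  | succ T ih =>
    simp only [Finset.sum_range_succ] at ih ⊢
    rw [ih]
    ring

/-! ### Fourier coefficients of the iterated integrals as nested sums. -/

namespace AperySeq

variable {p w : ℕ} {β : ℕ → ℚ}

/-- The cosine coefficients of the function with power series `β`. -/
noncomputable def coeff (β : ℕ → ℚ) (J : ℤ) : ℝ := cosTransform (fun N => (β N : ℝ)) J

/-- The cosine coefficients attached to the shifted sequence. -/
noncomputable def shiftCoeff (β : ℕ → ℚ) (J : ℤ) : ℝ :=
  cosTransform (fun N => (β (N + 1) : ℝ)) J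

/-- The value of the power series of the coefficients at `i`, doubled. -/
noncomputable def kappa (β : ℕ → ℚ) : ℂ :=
  Complex.I * (shiftCoeff β 0 + Complex.I * shiftCoeff β 1)

/-- The terms of the power series of the coefficients at `i`. -/
noncomputable def term (β : ℕ → ℚ) (n : ℕ) : ℂ := Complex.I ^ (n + 1) * coeff β ((n : ℤ) + 1)

lemma coeff_eq (h : AperySeq p (w + 1) β) (J : ℤ) :
    coeff β J = (shiftCoeff β (J - 1) + shiftCoeff β (J + 1)) / 2 :=
  h.logBound.cosTransform_shift (by simp [h.apply_zero]) J

lemma coeff_eq_zero (h : AperySeq p w β) {J : ℤ} (hJ : J % 2 ≠ p) : coeff β J = 0 :=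
  cosTransform_eq_zero (fun N hN => by simp [h.eq_zero_of_parity hN]) hJ

lemma shiftCoeff_eq_zero (h : AperySeq p w β) {J : ℤ} (hJ : (J + 1) % 2 ≠ p) :
    shiftCoeff β J = 0 := by
  have := h.parity_lt
  refine cosTransform_eq_zero (p := 1 - p) (fun N hN => ?_) (by omega)
  rw [h.eq_zero_of_parity (by omega), Rat.cast_zero]

/-- By `coeff_eq`, a coefficient is the mean of two shifted coefficients whose indices differ by 2;
since `i² = -1`, the weights `i^j` make the sum telescope. -/
lemma sum_term (h : AperySeq p (w + 1) β) (k : ℕ) :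
    ∑ j ∈ Finset.range k, 2 * term β j = kappa β -
      Complex.I * (Complex.I ^ k * shiftCoeff β k +
        Complex.I ^ (k + 1) * shiftCoeff β ((k : ℤ) + 1)) := by
  induction k with
  | zero => simp [kappa]
  | succ k ih =>
    rw [Finset.sum_range_succ, ih, term, h.coeff_eq, add_sub_cancel_right]
    push_cast
    linear_combination
      (Complex.I ^ (k + 1) * shiftCoeff β ((k : ℤ) + 1 + 1)) * Complex.I_sq

/-- The tail consists of two shifted coefficients, which beat every power of the logarithm by
`LogBound.tendsto`. -/
lemma tendsto_kappa_sub (h : AperySeq p (w + 1) β) {f : ℕ → ℂ} (hf : LogGrowth f) :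
    Filter.Tendsto (fun k => f k * (kappa β - ∑ j ∈ Finset.range k, 2 * term β j)) Filter.atTop
      (nhds 0) := by
  obtain ⟨C, m, hC, hf⟩ := hf
  have hl := h.logBound.shift
  rw [tendsto_zero_iff_norm_tendsto_zero]
  have h1 := ((hl.tendsto m).add (hl.tendsto_succ m)).const_mul C
  rw [add_zero, mul_zero] at h1
  refine squeeze_zero (fun k => norm_nonneg _) (fun k => ?_) h1
  have n1 : ‖(shiftCoeff β k : ℂ)‖ = shiftCoeff β k := by
    rw [Complex.norm_real]
    exact Real.norm_of_nonneg (hl.cosTransform_nonneg _)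
  have n2 : ‖(shiftCoeff β ((k : ℤ) + 1) : ℂ)‖ = shiftCoeff β ((k : ℤ) + 1) := by
    rw [Complex.norm_real]
    exact Real.norm_of_nonneg (hl.cosTransform_nonneg _)
  rw [h.sum_term, sub_sub_cancel, norm_mul, norm_mul, Complex.norm_I, one_mul]
  have n3 : ‖Complex.I ^ k * (shiftCoeff β k : ℂ) +
      Complex.I ^ (k + 1) * shiftCoeff β ((k : ℤ) + 1)‖ ≤
      shiftCoeff β k + shiftCoeff β ((k : ℤ) + 1) := by
    refine (norm_add_le _ _).trans_eq ?_
    rw [norm_mul, norm_mul, norm_pow, norm_pow, Complex.norm_I, one_pow, one_pow, one_mul, one_mul,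
      n1, n2]
  have hk := (harm_pos k).le
  refine (mul_le_mul (hf k) n3 (norm_nonneg _) (by positivity)).trans_eq ?_
  simp only [shiftCoeff]
  ring

lemma tendsto_kappa (h : AperySeq p (w + 1) β) :
    Filter.Tendsto (fun k => ∑ j ∈ Finset.range k, 2 * term β j) Filter.atTop
      (nhds (kappa β)) := by
  have h1 := h.tendsto_kappa_sub (f := 1) ⟨1, 0, zero_le_one, fun N => by simp⟩
  have h2 := (tendsto_const_nhds (x := kappa β)).sub h1
  simpa using h2

/-- At `φ = π/2` the cosine series takes the value of the power series at `x = 0`, which is 0 in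
positive weight. -/
lemma kappa_of_even (h : AperySeq 0 (w + 1) β) : kappa β = -coeff β 0 := by
  have h1 : shiftCoeff β 0 = 0 := h.shiftCoeff_eq_zero (by norm_num)
  have h2 : shiftCoeff β (-1) = shiftCoeff β 1 := by
    simp only [shiftCoeff, cosTransform, cosCoeff_neg]
  have h3 := h.coeff_eq 0
  rw [zero_sub, zero_add, h2] at h3
  rw [kappa, h1, h3]
  push_cast
  linear_combination (shiftCoeff β 1 : ℂ) * Complex.I_sq

/-- Here `shiftCoeff β 0` is the sum `∑ aₙ β(2n+1)` that is wanted. -/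
lemma kappa_of_odd (h : AperySeq 1 (w + 1) β) : kappa β = Complex.I * shiftCoeff β 0 := by
  have h1 : shiftCoeff β 1 = 0 := h.shiftCoeff_eq_zero (by norm_num)
  rw [kappa, h1]
  push_cast
  ring

lemma term_eq_zero (h : AperySeq p w β) {k : ℕ} (hk : (k + 1) % 2 ≠ p) : term β k = 0 := by
  rw [term, h.coeff_eq_zero (by omega), Complex.ofReal_zero, mul_zero]

/-- By parity `shiftCoeff β (k + 1)` vanishes, so the tails at `k` and `k + 1` isolate the shifted
coefficients at `k` and `k + 2`. Up to the power of `i`, their average is the difference in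
`LogBound.cosTransform_div`. -/
lemma term_div (h : AperySeq p (w + 1) β) (k : ℕ) :
    term (fun N => β N / N) k = if (k + 1) % 2 = p then letterSeq 1 1 k *
      (kappa β - (∑ j ∈ Finset.range k, 2 * term β j +
        ∑ j ∈ Finset.range (k + 1), 2 * term β j) / 2) else 0 := by
  split_ifs with hk
  · have h0 : shiftCoeff β ((k : ℤ) + 1) = 0 := h.shiftCoeff_eq_zero (by omega)
    have h1 := h.logBound.cosTransform_div ((k : ℤ) + 1)
    rw [add_sub_cancel_right] at h1
    have h2 : ((k : ℂ) + 1) * coeff (fun N => β N / N) ((k : ℤ) + 1) =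
        (shiftCoeff β k - shiftCoeff β ((k : ℤ) + 1 + 1)) / 2 := by
      rw [coeff, shiftCoeff, shiftCoeff]
      push_cast at h1 ⊢
      exact_mod_cast h1
    have h3 : (coeff (fun N => β N / N) ((k : ℤ) + 1) : ℂ) =
        (shiftCoeff β k - shiftCoeff β ((k : ℤ) + 1 + 1)) / 2 / ((k : ℂ) + 1) := by
      rw [← h2, mul_div_cancel_left₀ _ (Nat.cast_add_one_ne_zero k)]
    rw [h.sum_term, h.sum_term, term, h3, letterSeq]
    push_cast
    rw [h0]
    push_cast
    have hk : (k : ℂ) + 1 ≠ 0 := Nat.cast_add_one_ne_zero k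
    field_simp
    linear_combination
      (-Complex.I ^ (k + 1) * shiftCoeff β ((k : ℤ) + 1 + 1)) * Complex.I_sq
  · exact (AperySeq.div h).term_eq_zero hk

lemma coeff_sum (h : AperySeq p w β) {q : ℕ} (hq : q < 2) (k : ℕ) :
    (coeff (fun N => if N % 2 = q then (∑ M ∈ Finset.range N, β M) / N else 0) ((k : ℤ) + 1) : ℂ) =
      if (k + 1) % 2 = q then letterSeq 1 1 k * (coeff β ((k : ℤ) + 1) +
        (2 * ∑ j ∈ Finset.range k, (coeff β ((j : ℤ) + 1) : ℂ) + coeff β 0)) else 0 := by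
  split_ifs with hk
  · have h1 := h.logBound.cosTransform_sum (AperySeq.sum q hq h).logBound hq h.sum_le
      (fun N => by split_ifs <;> simp) k hk
    have h2 : ((k : ℂ) + 1) * coeff (fun N => if N % 2 = q then (∑ M ∈ Finset.range N, β M) / N
        else 0) ((k : ℤ) + 1) = coeff β ((k : ℤ) + 1) +
        2 * ∑ j ∈ Finset.range k, (coeff β ((j : ℤ) + 1) : ℂ) + coeff β 0 := by
      exact_mod_cast h1
    rw [← add_assoc, ← h2, letterSeq, one_pow, pow_one, one_div,
      inv_mul_cancel_left₀ (Nat.cast_add_one_ne_zero k)]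
  · rw [(AperySeq.sum q hq h).coeff_eq_zero (by omega), Complex.ofReal_zero]

lemma kappa_mem_cmzv (h : AperySeq p (w + 1) β)
    (hs : SumsInCMZV (w + 1 + 0 + 0) (term β * letterSeq 0 1 * 1)) :
    kappa β ∈ cmzv 4 (w + 1) := by
  obtain ⟨x, hx, hx'⟩ := hs.smul 2
  rwa [tendsto_nhds_unique h.tendsto_kappa (hx'.congr fun k => Finset.sum_congr rfl fun n _ => by
    simp [letterSeq, Rat.smul_def])]

lemma coeff_zero_mem_cmzv (h : AperySeq p (w + 1) β) (hκ : kappa β ∈ cmzv 4 (w + 1)) :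
    (coeff β 0 : ℂ) ∈ cmzv 4 (w + 1) := by
  have hp := h.parity_lt
  interval_cases p
  · rw [h.kappa_of_even] at hκ
    simpa using neg_mem hκ
  · rw [h.coeff_eq_zero (by norm_num), Complex.ofReal_zero]
    exact zero_mem _

/-- The coefficients, and the sums of the coefficients at `i` against nested sums. -/
theorem coeff_mem_and_sums (h : AperySeq p w β) :
    (fun n : ℕ => (coeff β ((n : ℤ) + 1) : ℂ)) ∈ summandMod w ∧
    (∀ (r m : ℕ) (f : ℕ → ℂ), f ∈ nestedSpan m →
      SumsInCMZV (w + r + m) (term β * letterSeq r 1 * f)) ∧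
    (coeff β 0 : ℂ) ∈ cmzv 4 w := by
  induction h with
  | one =>
    have e : ∀ J : ℤ, coeff (Pi.single 0 1) J = if J = 0 then 1 else 0 := fun J => by
      rw [coeff, cosTransform, tsum_eq_single 0]
      · simp [cosCoeff]
      · intro N hN
        simp [hN]
    have e1 : (fun n : ℕ => (coeff (Pi.single 0 1) ((n : ℤ) + 1) : ℂ)) = 0 := by
      funext n
      rw [e, if_neg (by omega)]
      simp
    refine ⟨?_, fun r m f _ => ?_, ?_⟩
    · rw [e1]
      exact zero_mem _
    · have : term (Pi.single 0 1) = 0 := by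
        funext n
        rw [term, congrFun e1 n, Pi.zero_apply, mul_zero]
      rw [this, zero_mul, zero_mul]
      exact SumsInCMZV.zero _
    · rw [e, if_pos rfl]
      exact_mod_cast one_mem_cmzv
  | @div p w β hb ih =>
    obtain ⟨ih1, ih2, -⟩ := ih
    have hκ := hb.kappa_mem_cmzv (ih2 0 0 1 one_mem_nestedSpan)
    have hp := hb.parity_lt
    -- For `r = 0` the letter `(r + 1, 1)` is inadmissible, so summing termwise fails. Summation by
    -- parts moves the sum onto `term β`, where the induction hypothesis applies to the nested sum
    -- of `d` and to `f` itself.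
    have hsum : ∀ (r m : ℕ) (f : ℕ → ℂ), f ∈ nestedSpan m →
        SumsInCMZV (w + 1 + 1 + r + m) (term (fun N => β N / N) * letterSeq r 1 * f) := by
      intro r m f hf
      set d : ℕ → ℂ := fun k => if (k + 1) % 2 = p then letterSeq (r + 1) 1 k * f k else 0 with hd
      have hF := sum_ite_parity_mem_nestedSpan (k := r + 1) (by omega) hp hf
      have s1 := (ih2 0 _ _ hF).smul 2
      have s2 := ih2 (r + 1) _ _ hf
      rw [show w + 1 + 0 + (r + 1 + m) = w + 1 + 1 + r + m by ring] at s1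
      rw [show w + 1 + (r + 1) + m = w + 1 + 1 + r + m by ring] at s2
      obtain ⟨x, hx, hx'⟩ := s1.add s2
      refine ⟨x, hx, ?_⟩
      -- Adds the boundary term of `sum_abel`, whose limit is 0.
      have h0 := (hb.tendsto_kappa_sub (logGrowth_of_mem hF)).add hx'
      rw [zero_add] at h0
      refine h0.congr fun T => ?_
      have e1 : ∀ k, (term (fun N => β N / N) * letterSeq r 1 * f) k = d k *
          (kappa β - (∑ j ∈ Finset.range k, 2 * term β j +
            ∑ j ∈ Finset.range (k + 1), 2 * term β j) / 2) := by
        intro k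
        rw [Pi.mul_apply, Pi.mul_apply, hb.term_div, hd]
        dsimp only
        split_ifs
        · rw [add_comm r 1, ← one_mul (1 : ℂ), ← letterSeq_mul, Pi.mul_apply, one_mul]
          ring
        · simp
      rw [Finset.sum_congr rfl fun k _ => e1 k, sum_abel]
      congr 1
      refine Finset.sum_congr rfl fun k _ => ?_
      simp only [Pi.add_apply, Pi.smul_apply, Pi.mul_apply, Rat.smul_def, hd]
      by_cases hk : (k + 1) % 2 = p
      · rw [if_pos hk]
        simp [letterSeq]
        ring
      · rw [hb.term_eq_zero hk]
        simp
    refine ⟨?_, hsum, coeff_zero_mem_cmzv (AperySeq.div hb)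
      (kappa_mem_cmzv (AperySeq.div hb) (hsum 0 0 1 one_mem_nestedSpan))⟩
    have ht : term β ∈ summandMod (w + 1) := by
      have h1 := letterSeq_mul_mem' (k := 0) (z := Complex.I) (by simp) ih1
      rw [zero_add] at h1
      convert h1 using 1
      funext n
      simp [term, letterSeq]
    have hX := sub_mem (const_mem_nestedMod hκ)
      (Submodule.smul_mem _ (2 : ℚ) (sum_mem_nestedMod ht))
    -- The letter with root `-i` undoes the factor `i^(k+1)` in `term`. The average of the partial
    -- sums at `k` and `k + 1` is the one at `k` plus `term β k`; the latter gives `m2`.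
    have m1 := letterSeq_mul_mem (k := 1) (z := -Complex.I) le_rfl
      (by rw [neg_pow, Complex.I_pow_four]; norm_num) hX
    have m2 := letterSeq_mul_mem' (k := 1) (z := 1) (by norm_num) ih1
    have m3 := ite_parity_mem_summandMod hp (sub_mem m1 m2)
    rw [show 1 + (w + 1) = w + 2 by ring] at m3
    convert m3 using 1
    funext k
    have hI : (-Complex.I) ^ (k + 1) * Complex.I ^ (k + 1) = 1 := by
      rw [← mul_pow]
      simp
    have e1 : (coeff (fun N => β N / N) ((k : ℤ) + 1) : ℂ) =
        (-Complex.I) ^ (k + 1) * term (fun N => β N / N) k := by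
      rw [term, ← mul_assoc, hI, one_mul]
    have e2 : (coeff β ((k : ℤ) + 1) : ℂ) = (-Complex.I) ^ (k + 1) * term β k := by
      rw [term, ← mul_assoc, hI, one_mul]
    rw [e1, hb.term_div]
    split_ifs
    · simp only [Pi.sub_apply, Pi.mul_apply, Pi.smul_apply, e2, letterSeq, Finset.sum_range_succ,
        ← Finset.mul_sum, Rat.smul_def]
      push_cast
      ring
    · simp
  | @sum p w β q hq hb ih =>
    obtain ⟨ih1, -, ih3⟩ := ih
    set v : ℕ → ℂ := fun n => (coeff β ((n : ℤ) + 1) : ℂ) with hv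
    set g : ℕ → ℂ := fun k => 2 * ∑ j ∈ Finset.range k, v j + coeff β 0 with hg
    have hgm : g ∈ nestedMod w := by
      convert add_mem (Submodule.smul_mem _ (2 : ℚ) (sum_mem_nestedMod ih1))
        (const_mem_nestedMod ih3) using 1
      funext k
      simp [hg, Rat.smul_def]
    have hsum : ∀ (r m : ℕ) (f : ℕ → ℂ), f ∈ nestedSpan m → SumsInCMZV (w + 1 + r + m)
        (term (fun N => if N % 2 = q then (∑ M ∈ Finset.range N, β M) / N else 0) *
          letterSeq r 1 * f) := by
      intro r m f hf
      -- The factor `i^(k+1)` and its twist by `(-1)^(k+1)` give the roots `i` and `-i`, both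
      -- different from 1, so every leading letter is admissible.
      have key : ∀ z : ℂ, z ^ 4 = 1 → z ≠ 1 →
          SumsInCMZV (w + 1 + r + m) (letterSeq (r + 1) z * f * (v + g)) := by
        intro z hz hz1
        have s1 := sumsInCMZV_letterSeq_mul' (k := r + 1) (by omega) hz hf ih1
        have s2 := sumsInCMZV_letterSeq_mul (k := r + 1) (by omega) hz (fun h => hz1 h.2)
          (mul_mem_nestedMod hf hgm)
        rw [show r + 1 + m + w = w + 1 + r + m by ring] at s1
        rw [show r + 1 + (m + w) = w + 1 + r + m by ring, ← mul_assoc] at s2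
        rw [mul_add]
        exact s1.add s2
      have k1 := key Complex.I Complex.I_pow_four (fun h => by
        simpa using congrArg Complex.re h)
      have k2 := key (-1 * Complex.I) (by rw [mul_pow, Complex.I_pow_four]; norm_num) (fun h => by
        simpa using congrArg Complex.re h)
      rw [← zero_add (r + 1), ← letterSeq_mul, mul_assoc (letterSeq 0 (-1)), mul_assoc (letterSeq 0 (-1))] at k2
      convert k1.ite_parity hq k2 using 1
      funext k
      simp only [Pi.mul_apply, term, hb.coeff_sum hq]
      split_ifs
      · simp only [letterSeq, Pi.add_apply, hg, hv, one_pow, pow_succ]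
        have hk : (k : ℂ) + 1 ≠ 0 := Nat.cast_add_one_ne_zero k
        field_simp
      · simp
    refine ⟨?_, hsum, coeff_zero_mem_cmzv (AperySeq.sum q hq hb)
      (kappa_mem_cmzv (AperySeq.sum q hq hb) (hsum 0 0 1 one_mem_nestedSpan))⟩
    have m1 := letterSeq_mul_mem' (k := 1) (z := 1) (by norm_num) ih1
    have m2 := letterSeq_mul_mem (k := 1) (z := 1) le_rfl (by norm_num) hgm
    have m3 := ite_parity_mem_summandMod hq (add_mem m1 m2)
    rw [add_comm 1 w] at m3
    convert m3 using 1
    funext k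
    rw [hb.coeff_sum hq]
    simp only [Pi.add_apply, Pi.mul_apply, hv, hg, mul_add]

end AperySeq

/-! ### Pairing the sequences with `aₙ`. -/

/-- The span of the sequences `n ↦ β (2n)` of weight in `V`. -/
def evenSpan (V : Set ℕ) : Submodule ℚ (ℕ → ℚ) :=
  Submodule.span ℚ {b | ∃ v ∈ V, ∃ β, AperySeq 0 v β ∧ b = fun n => β (2 * n)}

/-- The span of the sequences `n ↦ β (2n + 1)` of weight in `V`. -/
def oddSpan (V : Set ℕ) : Submodule ℚ (ℕ → ℚ) :=
  Submodule.span ℚ {b | ∃ v ∈ V, ∃ β, AperySeq 1 v β ∧ b = fun n => β (2 * n + 1)}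

lemma AperySeq.even_mem {V : Set ℕ} {v : ℕ} {β : ℕ → ℚ} (h : AperySeq 0 v β) (hv : v ∈ V) :
    (fun n => β (2 * n)) ∈ evenSpan V :=
  Submodule.subset_span ⟨v, hv, β, h, rfl⟩

lemma AperySeq.odd_mem {V : Set ℕ} {v : ℕ} {β : ℕ → ℚ} (h : AperySeq 1 v β) (hv : v ∈ V) :
    (fun n => β (2 * n + 1)) ∈ oddSpan V :=
  Submodule.subset_span ⟨v, hv, β, h, rfl⟩

lemma evenSpan_mono {V W : Set ℕ} (h : V ⊆ W) : evenSpan V ≤ evenSpan W :=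
  Submodule.span_mono fun _ ⟨v, hv, hb⟩ => ⟨v, h hv, hb⟩

lemma oddSpan_mono {V W : Set ℕ} (h : V ⊆ W) : oddSpan V ≤ oddSpan W :=
  Submodule.span_mono fun _ ⟨v, hv, hb⟩ => ⟨v, h hv, hb⟩

/-- The series `∑ aₙ bₙ` converges to an element of `M`. -/
def PairsInto (M : Submodule ℚ ℂ) (b : ℕ → ℚ) : Prop :=
  ∃ S : ℝ, HasSum (fun n => aperyCoeff n * (b n : ℝ)) S ∧ (S : ℂ) ∈ M

lemma PairsInto.add {M : Submodule ℚ ℂ} {b b' : ℕ → ℚ} (h : PairsInto M b)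
    (h' : PairsInto M b') : PairsInto M (b + b') := by
  obtain ⟨S, h1, h2⟩ := h
  obtain ⟨S', h1', h2'⟩ := h'
  refine ⟨S + S', ?_, ?_⟩
  · simpa [mul_add] using h1.add h1'
  · rw [Complex.ofReal_add]
    exact add_mem h2 h2'

lemma PairsInto.smul {M : Submodule ℚ ℂ} {b : ℕ → ℚ} (h : PairsInto M b) (q : ℚ) :
    PairsInto M (q • b) := by
  obtain ⟨S, h1, h2⟩ := h
  refine ⟨q * S, ?_, ?_⟩
  · have h3 := h1.mul_left (q : ℝ)
    have e : (fun n => aperyCoeff n * (((q • b) n : ℚ) : ℝ)) =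
        fun n => (q : ℝ) * (aperyCoeff n * (b n : ℝ)) := by
      funext n
      simp only [Pi.smul_apply, smul_eq_mul, Rat.cast_mul]
      ring
    rwa [e]
  · have h3 := M.smul_mem q h2
    rw [Rat.smul_def] at h3
    exact_mod_cast h3

lemma pairsInto_of_mem_span {M : Submodule ℚ ℂ} {s : Set (ℕ → ℚ)} (hs : ∀ b ∈ s, PairsInto M b)
    {b : ℕ → ℚ} (hb : b ∈ Submodule.span ℚ s) : PairsInto M b :=
  Submodule.span_induction hs ⟨0, by simp [hasSum_zero], zero_mem _⟩
    (fun _ _ _ _ => PairsInto.add) (fun q _ _ h => h.smul q) hb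

namespace AperySeq

variable {w : ℕ} {β : ℕ → ℚ}

/-- Only even exponents occur, and `cosCoeff (2n) 0 = aₙ`, so the sum is the constant coefficient.
-/
lemma pairsInto_even (h : AperySeq 0 w β) : PairsInto (cmzv 4 w) fun n => β (2 * n) := by
  refine ⟨coeff β 0, ?_, h.coeff_mem_and_sums.2.2⟩
  have h1 := (h.logBound.summable 0).hasSum
  have hinj : Function.Injective fun n : ℕ => 2 * n := fun a b hab => by
    simpa using hab
  rw [← hinj.hasSum_iff] at h1
  · have e : (fun n => aperyCoeff n * (β (2 * n) : ℝ)) =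
        (fun N => (β N : ℝ) * cosCoeff N 0) ∘ fun n => 2 * n := by
      funext n
      rw [Function.comp_apply, cosCoeff_even_zero, mul_comm]
    rwa [e]
  · intro N hN
    rw [h.eq_zero_of_parity, Rat.cast_zero, zero_mul]
    intro h0
    exact hN ⟨N / 2, by dsimp only; omega⟩

lemma pairsInto_odd (h : AperySeq 1 w β) :
    PairsInto ((cmzv 4 w).map (LinearMap.mulLeft ℚ Complex.I)) fun n => β (2 * n + 1) := by
  cases w with
  | zero => cases h
  | succ w =>
    have hκ := h.kappa_mem_cmzv (h.coeff_mem_and_sums.2.1 0 0 1 one_mem_nestedSpan)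
    rw [h.kappa_of_odd] at hκ
    -- From `κ = iS` follows `S = i(-κ)`.
    refine ⟨shiftCoeff β 0, ?_, Submodule.mem_map.2 ⟨_, neg_mem hκ, ?_⟩⟩
    · have h1 := (h.logBound.shift.summable 0).hasSum
      have hinj : Function.Injective fun n : ℕ => 2 * n := fun a b hab => by
        simpa using hab
      rw [← hinj.hasSum_iff] at h1
      · have e : (fun n => aperyCoeff n * (β (2 * n + 1) : ℝ)) =
            (fun N => (β (N + 1) : ℝ) * cosCoeff N 0) ∘ fun n => 2 * n := by
          funext n
          rw [Function.comp_apply, cosCoeff_even_zero, mul_comm]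
        rwa [e]
      · intro N hN
        rw [h.eq_zero_of_parity, Rat.cast_zero, zero_mul]
        intro h0
        exact hN ⟨N / 2, by dsimp only; omega⟩
    · rw [LinearMap.mulLeft_apply]
      linear_combination (-shiftCoeff β 0 : ℂ) * Complex.I_sq

end AperySeq

/-! ### Division by linear forms and partial sums. -/

/-- Termwise division by a linear form. -/
def divForm (l : ℕ → ℕ) : (ℕ → ℚ) →ₗ[ℚ] (ℕ → ℚ) where
  toFun b n := b n / l n
  map_add' b b' := by
    funext n
    exact add_div _ _ _
  map_smul' q b := by
    funext n
    exact mul_div_assoc _ _ _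

lemma divForm_apply (l : ℕ → ℕ) (b : ℕ → ℚ) (n : ℕ) : divForm l b n = b n / l n := rfl

/-- The indices `m` with `n > m`, or with `n ≥ m`. -/
def Ineq.lower : Ineq → ℕ → Finset ℕ
  | .gt, n => Finset.range n
  | .ge, n => Finset.range (n + 1)

/-- The partial sums of a sequence. -/
def partialSum (q : Ineq) : (ℕ → ℚ) →ₗ[ℚ] (ℕ → ℚ) where
  toFun b n := ∑ m ∈ q.lower n, b m
  map_add' b b' := by
    funext n
    exact Finset.sum_add_distrib
  map_smul' q b := by
    funext n
    exact (Finset.mul_sum _ _ _).symm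

lemma partialSum_apply (q : Ineq) (b : ℕ → ℚ) (n : ℕ) :
    partialSum q b n = ∑ m ∈ q.lower n, b m := rfl

lemma partialSum_ge (b : ℕ → ℚ) : partialSum .ge b = partialSum .gt b + b := by
  funext n
  simp [partialSum_apply, Ineq.lower, Finset.sum_range_succ]

lemma sum_range_two_mul (β : ℕ → ℚ) (n : ℕ) :
    ∑ M ∈ Finset.range (2 * n), β M = ∑ m ∈ Finset.range n, (β (2 * m) + β (2 * m + 1)) := by
  induction n with
  | zero => simp
  | succ n ih =>
    rw [Finset.sum_range_succ, ← ih, show 2 * (n + 1) = 2 * n + 1 + 1 by ring,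
      Finset.sum_range_succ, Finset.sum_range_succ, add_assoc]

lemma AperySeq.sum_range_even {v : ℕ} {β : ℕ → ℚ} (h : AperySeq 0 v β) (n : ℕ) :
    ∑ M ∈ Finset.range (2 * n), β M = ∑ m ∈ Finset.range n, β (2 * m) := by
  rw [sum_range_two_mul]
  exact Finset.sum_congr rfl fun m _ => by
    rw [h.eq_zero_of_parity (N := 2 * m + 1) (by omega), add_zero]

lemma AperySeq.sum_range_odd {v : ℕ} {β : ℕ → ℚ} (h : AperySeq 1 v β) (n : ℕ) :
    ∑ M ∈ Finset.range (2 * n), β M = ∑ m ∈ Finset.range n, β (2 * m + 1) := by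
  rw [sum_range_two_mul]
  exact Finset.sum_congr rfl fun m _ => by
    rw [h.eq_zero_of_parity (N := 2 * m) (by omega), zero_add]

lemma divForm_even_mem {V W : Set ℕ} (hVW : ∀ v ∈ V, v + 1 ∈ W) {b : ℕ → ℚ}
    (hb : b ∈ evenSpan V) : divForm evenForm b ∈ evenSpan W := by
  have : evenSpan V ≤ (evenSpan W).comap (divForm evenForm) := by
    refine Submodule.span_le.2 ?_
    rintro _ ⟨v, hv, β, h, rfl⟩
    cases v with
    -- In weight 0 only the delta sequence at 0 occurs, and division by `2 · 0` annihilates it.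
    | zero =>
      have : divForm evenForm (fun n => β (2 * n)) = 0 := by
        funext n
        cases h
        rcases n with _ | n <;> simp [divForm_apply, evenForm]
      simp [this]
    | succ v => exact (AperySeq.div h).even_mem (hVW _ hv)
  exact this hb

lemma divForm_odd_mem {V W : Set ℕ} (hVW : ∀ v ∈ V, v + 1 ∈ W) {b : ℕ → ℚ}
    (hb : b ∈ oddSpan V) : divForm oddForm b ∈ oddSpan W := by
  have : oddSpan V ≤ (oddSpan W).comap (divForm oddForm) := by
    refine Submodule.span_le.2 ?_
    rintro _ ⟨v, hv, β, h, rfl⟩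
    cases v with
    | zero => cases h
    | succ v => exact (AperySeq.div h).odd_mem (hVW _ hv)
  exact this hb

/-- In this and the next three lemmas the symbol is dictated by `M < N` for exponents: `2m < 2n`,
`2m+1 < 2n` and `2m+1 < 2n+1` all mean `m < n`, whereas `2m < 2n+1` means `m ≤ n`. -/
lemma divForm_even_sum_even_mem {V W : Set ℕ} (hVW : ∀ v ∈ V, v + 1 ∈ W) {b : ℕ → ℚ}
    (hb : b ∈ evenSpan V) : divForm evenForm (partialSum .gt b) ∈ evenSpan W := by
  have : evenSpan V ≤ (evenSpan W).comap (divForm evenForm ∘ₗ partialSum .gt) := by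
    refine Submodule.span_le.2 ?_
    rintro _ ⟨v, hv, β, h, rfl⟩
    rw [SetLike.mem_coe, Submodule.mem_comap, LinearMap.comp_apply]
    convert (AperySeq.sum 0 two_pos h).even_mem (hVW _ hv) using 1
    funext n
    rw [if_pos (by omega), h.sum_range_even]
    rfl
  exact this hb

lemma divForm_even_sum_odd_mem {V W : Set ℕ} (hVW : ∀ v ∈ V, v + 1 ∈ W) {b : ℕ → ℚ}
    (hb : b ∈ oddSpan V) : divForm evenForm (partialSum .gt b) ∈ evenSpan W := by
  have : oddSpan V ≤ (evenSpan W).comap (divForm evenForm ∘ₗ partialSum .gt) := by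
    refine Submodule.span_le.2 ?_
    rintro _ ⟨v, hv, β, h, rfl⟩
    rw [SetLike.mem_coe, Submodule.mem_comap, LinearMap.comp_apply]
    convert (AperySeq.sum 0 two_pos h).even_mem (hVW _ hv) using 1
    funext n
    rw [if_pos (by omega), h.sum_range_odd]
    rfl
  exact this hb

lemma divForm_odd_sum_even_mem {V W : Set ℕ} (hVW : ∀ v ∈ V, v + 1 ∈ W) {b : ℕ → ℚ}
    (hb : b ∈ evenSpan V) : divForm oddForm (partialSum .ge b) ∈ oddSpan W := by
  have : evenSpan V ≤ (oddSpan W).comap (divForm oddForm ∘ₗ partialSum .ge) := by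
    refine Submodule.span_le.2 ?_
    rintro _ ⟨v, hv, β, h, rfl⟩
    rw [SetLike.mem_coe, Submodule.mem_comap, LinearMap.comp_apply]
    convert (AperySeq.sum 1 one_lt_two h).odd_mem (hVW _ hv) using 1
    funext n
    rw [if_pos (by omega), Finset.sum_range_succ, h.sum_range_even, ← Finset.sum_range_succ]
    rfl
  exact this hb

lemma divForm_odd_sum_odd_mem {V W : Set ℕ} (hVW : ∀ v ∈ V, v + 1 ∈ W) {b : ℕ → ℚ}
    (hb : b ∈ oddSpan V) : divForm oddForm (partialSum .gt b) ∈ oddSpan W := by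
  have : oddSpan V ≤ (oddSpan W).comap (divForm oddForm ∘ₗ partialSum .gt) := by
    refine Submodule.span_le.2 ?_
    rintro _ ⟨v, hv, β, h, rfl⟩
    rw [SetLike.mem_coe, Submodule.mem_comap, LinearMap.comp_apply]
    convert (AperySeq.sum 1 one_lt_two h).odd_mem (hVW _ hv) using 1
    funext n
    rw [if_pos (by omega), Finset.sum_range_succ, h.sum_range_odd,
      h.eq_zero_of_parity (N := 2 * n) (by omega), add_zero]
    rfl
  exact this hb

/-- The span of all the sequences of weight at most `w`. -/
def seqSpan (w : ℕ) : Submodule ℚ (ℕ → ℚ) := evenSpan (Set.Iic w) ⊔ oddSpan (Set.Iic w)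

lemma seqSpan_mono {v w : ℕ} (h : v ≤ w) : seqSpan v ≤ seqSpan w :=
  sup_le_sup (evenSpan_mono (Set.Iic_subset_Iic.2 h)) (oddSpan_mono (Set.Iic_subset_Iic.2 h))

lemma evenSpan_le_seqSpan (w : ℕ) : evenSpan (Set.Iic w) ≤ seqSpan w := le_sup_left

lemma oddSpan_le_seqSpan (w : ℕ) : oddSpan (Set.Iic w) ≤ seqSpan w := le_sup_right

lemma single_mem_evenSpan {V : Set ℕ} (h : 0 ∈ V) : (Pi.single 0 1 : ℕ → ℚ) ∈ evenSpan V := by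
  convert AperySeq.one.even_mem h using 1
  funext n
  rcases n with _ | n <;> simp

/-- Partial fractions. At `n = 0` division by `2n` gives 0, and the delta term cancels the remaining
`-b 0`. -/
lemma divForm_even_divForm_odd (b : ℕ → ℚ) :
    divForm evenForm (divForm oddForm b) =
      divForm evenForm b - divForm oddForm b + b 0 • Pi.single 0 1 := by
  funext n
  rcases n with _ | n
  · simp [divForm_apply, evenForm, oddForm]
  · simp only [divForm_apply, evenForm, oddForm, Pi.add_apply, Pi.sub_apply, Pi.smul_apply]
    rw [Pi.single_eq_of_ne (by omega)]
    push_cast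
    field_simp
    ring

lemma divForm_odd_divForm_even {b : ℕ → ℚ} (hb : b 0 = 0) :
    divForm oddForm (divForm evenForm b) = divForm evenForm b - divForm oddForm b := by
  have h := divForm_even_divForm_odd b
  rw [hb, zero_smul, add_zero] at h
  rw [← h]
  funext n
  simp only [divForm_apply]
  ring

lemma succ_mem_Iic_succ (w : ℕ) : ∀ v ∈ Set.Iic w, v + 1 ∈ Set.Iic (w + 1) := fun _ hv =>
  Nat.succ_le_succ hv

/-- Dividing by the form of the other parity does not raise the weight bound: a sequence of positive
weight already has a factor `1/l(n)`, and partial fractions replace the product of two factors by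
single ones. The delta sequence is unchanged by division by `2n+1`. This is the source of mixed
weights. -/
lemma AperySeq.divForm_mem {p w : ℕ} {β : ℕ → ℚ} (h : AperySeq p w β) :
    (p = 0 → divForm oddForm (fun n => β (2 * n)) ∈ seqSpan w) ∧
      (p = 1 → divForm evenForm (fun n => β (2 * n + 1)) ∈ seqSpan w) := by
  have hone : ∀ w, (Pi.single 0 1 : ℕ → ℚ) ∈ seqSpan w := fun w =>
    evenSpan_le_seqSpan w (single_mem_evenSpan (Nat.zero_le w))
  induction h with
  | one =>
    refine ⟨fun _ => ?_, fun h => by omega⟩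
    convert hone 0 using 1
    funext n
    rcases n with _ | n <;> simp [divForm_apply, oddForm]
  | @div p w β hb ih =>
    constructor
    · rintro rfl
      have e : (fun n => β (2 * n) / ((2 * n : ℕ) : ℚ)) = divForm evenForm fun n => β (2 * n) := rfl
      rw [e, divForm_odd_divForm_even (b := fun n => β (2 * n)) hb.apply_zero]
      exact sub_mem (evenSpan_le_seqSpan _ (hb.div.even_mem (Set.mem_Iic.2 le_rfl)))
        (seqSpan_mono (Nat.le_succ _) (ih.1 rfl))
    · rintro rfl
      have e : (fun n => β (2 * n + 1) / ((2 * n + 1 : ℕ) : ℚ)) =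
        divForm oddForm fun n => β (2 * n + 1) := rfl
      rw [e, divForm_even_divForm_odd]
      exact add_mem (sub_mem (seqSpan_mono (Nat.le_succ _) (ih.2 rfl))
        (oddSpan_le_seqSpan _ (hb.div.odd_mem (Set.mem_Iic.2 le_rfl))))
        (Submodule.smul_mem _ _ (hone _))
  | @sum p w β q hq hb ih =>
    have hw := succ_mem_Iic_succ w
    have hp := hb.parity_lt
    constructor
    · rintro rfl
      have e : (fun n => if 2 * n % 2 = 0 then
          (∑ M ∈ Finset.range (2 * n), β M) / ((2 * n : ℕ) : ℚ) else 0) =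
          divForm evenForm fun n => ∑ M ∈ Finset.range (2 * n), β M := by
        funext n
        rw [if_pos (by omega)]
        rfl
      rw [e, divForm_odd_divForm_even (by simp)]
      interval_cases p
      · have hbm := hb.even_mem (V := Set.Iic w) (Set.mem_Iic.2 le_rfl)
        simp only [hb.sum_range_even]
        refine sub_mem (evenSpan_le_seqSpan _ (divForm_even_sum_even_mem hw hbm)) ?_
        -- The odd form wants `≥` here; passing to `>` removes a diagonal term, which is covered by
        -- the induction hypothesis.
        have h1 := oddSpan_le_seqSpan _ (divForm_odd_sum_even_mem hw hbm)
        rw [partialSum_ge, map_add] at h1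
        have h2 := sub_mem h1 (seqSpan_mono (Nat.le_succ _) (ih.1 rfl))
        rwa [add_sub_cancel_right] at h2
      · have hbm := hb.odd_mem (V := Set.Iic w) (Set.mem_Iic.2 le_rfl)
        simp only [hb.sum_range_odd]
        exact sub_mem (evenSpan_le_seqSpan _ (divForm_even_sum_odd_mem hw hbm))
          (oddSpan_le_seqSpan _ (divForm_odd_sum_odd_mem hw hbm))
    · rintro rfl
      have e : (fun n => if (2 * n + 1) % 2 = 1 then
          (∑ M ∈ Finset.range (2 * n + 1), β M) / ((2 * n + 1 : ℕ) : ℚ) else 0) =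
          divForm oddForm fun n => ∑ M ∈ Finset.range (2 * n + 1), β M := by
        funext n
        rw [if_pos (by omega)]
        rfl
      rw [e, divForm_even_divForm_odd]
      refine add_mem ?_ (Submodule.smul_mem _ _ (hone _))
      interval_cases p
      · have hbm := hb.even_mem (V := Set.Iic w) (Set.mem_Iic.2 le_rfl)
        have e2 : (fun n => ∑ M ∈ Finset.range (2 * n + 1), β M) =
            partialSum .ge fun n => β (2 * n) := by
          funext n
          rw [Finset.sum_range_succ, hb.sum_range_even, ← Finset.sum_range_succ]
          rfl
        rw [e2]
        refine sub_mem ?_ (oddSpan_le_seqSpan _ (divForm_odd_sum_even_mem hw hbm))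
        rw [partialSum_ge, map_add]
        exact evenSpan_le_seqSpan _ (add_mem (divForm_even_sum_even_mem hw hbm)
          (divForm_even_mem hw hbm))
      · have hbm := hb.odd_mem (V := Set.Iic w) (Set.mem_Iic.2 le_rfl)
        have e2 : (fun n => ∑ M ∈ Finset.range (2 * n + 1), β M) =
            partialSum .gt fun n => β (2 * n + 1) := by
          funext n
          rw [Finset.sum_range_succ, hb.sum_range_odd,
            hb.eq_zero_of_parity (N := 2 * n) (by omega), add_zero]
          rfl
        rw [e2]
        exact sub_mem (evenSpan_le_seqSpan _ (divForm_even_sum_odd_mem hw hbm))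
          (oddSpan_le_seqSpan _ (divForm_odd_sum_odd_mem hw hbm))

lemma divForm_odd_even_mem {w : ℕ} {b : ℕ → ℚ} (hb : b ∈ evenSpan (Set.Iic w)) :
    divForm oddForm b ∈ seqSpan w := by
  have : evenSpan (Set.Iic w) ≤ (seqSpan w).comap (divForm oddForm) := by
    refine Submodule.span_le.2 ?_
    rintro _ ⟨v, hv, β, h, rfl⟩
    exact seqSpan_mono hv (h.divForm_mem.1 rfl)
  exact this hb

lemma divForm_even_odd_mem {w : ℕ} {b : ℕ → ℚ} (hb : b ∈ oddSpan (Set.Iic w)) :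
    divForm evenForm b ∈ seqSpan w := by
  have : oddSpan (Set.Iic w) ≤ (seqSpan w).comap (divForm evenForm) := by
    refine Submodule.span_le.2 ?_
    rintro _ ⟨v, hv, β, h, rfl⟩
    exact seqSpan_mono hv (h.divForm_mem.2 rfl)
  exact this hb

lemma divForm_mem_seqSpan {w : ℕ} {l : ℕ → ℕ} (hl : l = evenForm ∨ l = oddForm) {b : ℕ → ℚ}
    (hb : b ∈ seqSpan w) : divForm l b ∈ seqSpan (w + 1) := by
  have hw := succ_mem_Iic_succ w
  obtain ⟨b₀, h₀, b₁, h₁, rfl⟩ := Submodule.mem_sup.1 hb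
  rw [map_add]
  rcases hl with rfl | rfl
  · exact add_mem (evenSpan_le_seqSpan _ (divForm_even_mem hw h₀))
      (seqSpan_mono (Nat.le_succ _) (divForm_even_odd_mem h₁))
  · exact add_mem (seqSpan_mono (Nat.le_succ _) (divForm_odd_even_mem h₀))
      (oddSpan_le_seqSpan _ (divForm_odd_mem hw h₁))

/-- Even when the tail mixes both parities, an outermost step with the standard symbol lands in a
single parity. This separates cases 1 and 2 from case 3; `divForm_odd_sum_mem` is the odd
counterpart. -/
lemma divForm_even_sum_mem {w : ℕ} {b : ℕ → ℚ} (hb : b ∈ seqSpan w) :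
    divForm evenForm (partialSum .gt b) ∈ evenSpan (Set.Iic (w + 1)) := by
  have hw := succ_mem_Iic_succ w
  obtain ⟨b₀, h₀, b₁, h₁, rfl⟩ := Submodule.mem_sup.1 hb
  rw [map_add, map_add]
  exact add_mem (divForm_even_sum_even_mem hw h₀) (divForm_even_sum_odd_mem hw h₁)

lemma divForm_odd_sum_mem {w : ℕ} {b : ℕ → ℚ} (hb : b ∈ seqSpan w) :
    divForm oddForm (partialSum .ge b) ∈ oddSpan (Set.Iic (w + 1)) := by
  have hw := succ_mem_Iic_succ w
  obtain ⟨b₀, h₀, b₁, h₁, rfl⟩ := Submodule.mem_sup.1 hb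
  rw [map_add, map_add]
  refine add_mem (divForm_odd_sum_even_mem hw h₀) ?_
  rw [partialSum_ge, map_add]
  exact add_mem (divForm_odd_sum_odd_mem hw h₁) (divForm_odd_mem hw h₁)

lemma divForm_sum_mem_seqSpan {w : ℕ} {l : ℕ → ℕ} (hl : l = evenForm ∨ l = oddForm) (q : Ineq)
    {b : ℕ → ℚ} (hb : b ∈ seqSpan w) : divForm l (partialSum q b) ∈ seqSpan (w + 1) := by
  have h1 := evenSpan_le_seqSpan _ (divForm_even_sum_mem hb)
  have h2 := oddSpan_le_seqSpan _ (divForm_odd_sum_mem hb)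
  rcases hl with rfl | rfl
  · cases q with
    | gt => exact h1
    | ge =>
      rw [partialSum_ge, map_add]
      exact add_mem h1 (divForm_mem_seqSpan (Or.inl rfl) hb)
  · cases q with
    | ge => exact h2
    | gt =>
      have h3 := sub_mem h2 (divForm_mem_seqSpan (Or.inr rfl) hb)
      rwa [partialSum_ge, map_add, add_sub_cancel_right] at h3

lemma divForm_pow_apply (l : ℕ → ℕ) (s : ℕ) (b : ℕ → ℚ) (n : ℕ) :
    ((divForm l) ^ s) b n = b n / (l n : ℚ) ^ s := by
  induction s with
  | zero => simp
  | succ s ih => rw [pow_succ', Module.End.mul_apply, divForm_apply, ih, pow_succ, div_div]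

/-! ### From the multiple series to a single series in the first index. -/

/-- The sum of `1 / ∏ lⱼ(nⱼ) ^ sⱼ` over the chains with given first index `n₁`. -/
def chainSeq : (k : ℕ) → (Fin k → ℕ → ℕ) → (Fin k → ℕ) → (Fin k → Ineq) → ℕ → ℚ
  | 0, _, _, _ => Pi.single 0 1
  | k + 1, l, s, r => ((divForm (l 0)) ^ s 0) (partialSum (r 0)
      (chainSeq k (fun j => l j.succ) (fun j => s j.succ) (fun j => r j.succ)))

lemma chainSeq_succ (k : ℕ) (l : Fin (k + 1) → ℕ → ℕ) (s : Fin (k + 1) → ℕ)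
    (r : Fin (k + 1) → Ineq) : chainSeq (k + 1) l s r = ((divForm (l 0)) ^ s 0) (partialSum (r 0)
      (chainSeq k (fun j => l j.succ) (fun j => s j.succ) (fun j => r j.succ))) := rfl

lemma chainSeq_nonneg (k : ℕ) (l : Fin k → ℕ → ℕ) (s : Fin k → ℕ) (r : Fin k → Ineq) (n : ℕ) :
    0 ≤ chainSeq k l s r n := by
  induction k generalizing n with
  | zero => by_cases hn : n = 0 <;> simp [chainSeq, hn]
  | succ k ih =>
    rw [chainSeq_succ, divForm_pow_apply, partialSum_apply]
    exact div_nonneg (Finset.sum_nonneg fun m _ => ih _ _ _ m) (by positivity)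

lemma Ineq.mem_lower {q : Ineq} {m n : ℕ} : m ∈ q.lower n ↔ q.Holds n m := by
  cases q <;> simp [Ineq.lower, Ineq.Holds]

lemma cons_mem_chain {d : ℕ} {r : Fin (d + 2) → Ineq} {m : ℕ} {n : Fin (d + 1) → ℕ} :
    (Fin.cons m n : Fin (d + 2) → ℕ) ∈ chain r ↔
      (r 0).Holds m (n 0) ∧ n ∈ chain fun j => r j.succ := by
  simp only [chain, Set.mem_ofPred_eq, Fin.forall_fin_succ (n := d), ← Fin.succ_last,
    Fin.cons_succ, Fin.castSucc_zero, Fin.cons_zero, ← Fin.succ_castSucc, and_assoc]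

-- All terms lie in `[0, ∞]`, so the order of summation is free. The arbitrary weight `G` makes the
-- induction work: the first index and its symbol are absorbed into the weight of the tail.
open Classical in
lemma tsum_chain {d : ℕ} (l : Fin (d + 1) → ℕ → ℕ) (s : Fin (d + 1) → ℕ)
    (r : Fin (d + 1) → Ineq) (G : ℕ → ENNReal) :
    ∑' n : Fin (d + 1) → ℕ, (if n ∈ chain r then
        G (n 0) * ∏ j, ENNReal.ofReal (1 / (l j (n j) : ℝ) ^ s j) else 0) =
      ∑' m, G m * ENNReal.ofReal (chainSeq (d + 1) l s r m : ℝ) := by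
  have hB : ∀ (k : ℕ) (l : Fin (k + 1) → ℕ → ℕ) (s : Fin (k + 1) → ℕ) (r : Fin (k + 1) → Ineq)
      (m : ℕ), ENNReal.ofReal (chainSeq (k + 1) l s r m : ℝ) =
        ENNReal.ofReal (1 / (l 0 m : ℝ) ^ s 0) * ∑ x ∈ (r 0).lower m, ENNReal.ofReal
          (chainSeq k (fun j => l j.succ) (fun j => s j.succ) (fun j => r j.succ) x : ℝ) := by
    intro k l s r m
    rw [chainSeq_succ, divForm_pow_apply, partialSum_apply, ← ENNReal.ofReal_sum_of_nonneg
      (fun x _ => Rat.cast_nonneg.2 (chainSeq_nonneg _ _ _ _ x)),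
      ← ENNReal.ofReal_mul (by positivity)]
    push_cast
    congr 1
    ring
  induction d generalizing G with
  | zero =>
    rw [← (Equiv.funUnique (Fin 1) ℕ).symm.tsum_eq]
    refine tsum_congr fun m => ?_
    rw [hB]
    have e : (∑ x ∈ (r 0).lower m, ENNReal.ofReal (chainSeq 0 (fun j => l j.succ)
        (fun j => s j.succ) (fun j => r j.succ) x : ℝ)) = if (r 0).Holds m 0 then 1 else 0 := by
      have e1 : ∀ x, ENNReal.ofReal (chainSeq 0 (fun j => l j.succ)
          (fun j => s j.succ) (fun j => r j.succ) x : ℝ) = if x = 0 then 1 else 0 := fun x => by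
        by_cases hx : x = 0 <;> simp [chainSeq, hx]
      simp only [e1, Finset.sum_ite_eq', Ineq.mem_lower]
    rw [e]
    have e2 : (Equiv.funUnique (Fin 1) ℕ).symm m ∈ chain r ↔ (r 0).Holds m 0 := by
      simp [chain]
    by_cases h : (r 0).Holds m 0
    · rw [if_pos (e2.2 h), if_pos h]
      simp
    · rw [if_neg (fun h' => h (e2.1 h')), if_neg h]
      simp
  | succ d ih =>
    rw [← (Fin.consEquiv fun _ => ℕ).tsum_eq, ENNReal.tsum_prod']
    refine tsum_congr fun m => ?_
    have h1 := ih (fun j => l j.succ) (fun j => s j.succ) (fun j => r j.succ)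
      (fun x => if x ∈ (r 0).lower m then G m * ENNReal.ofReal (1 / (l 0 m : ℝ) ^ s 0) else 0)
    rw [tsum_eq_sum (s := (r 0).lower m) (fun x hx => by rw [if_neg hx, zero_mul])] at h1
    rw [hB, ← mul_assoc, Finset.mul_sum]
    refine Eq.trans ?_ (h1.trans (Finset.sum_congr rfl fun x hx => by rw [if_pos hx]))
    refine tsum_congr fun n => ?_
    have e : (Fin.consEquiv fun _ => ℕ) (m, n) = (Fin.cons m n : Fin (d + 2) → ℕ) := rfl
    rw [e]
    simp only [cons_mem_chain, Ineq.mem_lower]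
    by_cases h2 : n ∈ chain fun j => r j.succ
    · by_cases h3 : (r 0).Holds m (n 0)
      · rw [if_pos ⟨h3, h2⟩, if_pos h2, if_pos h3, Fin.prod_univ_succ]
        simp [mul_assoc]
      · rw [if_neg (fun h => h3 h.1), if_pos h2, if_neg h3, zero_mul]
    · rw [if_neg (fun h => h2 h.2), if_neg h2]

lemma hasAperySum_of_hasSum {d : ℕ} {l : Fin (d + 1) → ℕ → ℕ} {s : Fin (d + 1) → ℕ}
    {r : Fin (d + 1) → Ineq} {S : ℝ}
    (h : HasSum (fun n => aperyCoeff n * (chainSeq (d + 1) l s r n : ℝ)) S) :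
    HasAperySum l s r S := by
  classical
  have hc : ∀ n, (0 : ℝ) ≤ chainSeq (d + 1) l s r n := fun n =>
    Rat.cast_nonneg.2 (chainSeq_nonneg _ _ _ _ n)
  have hnn : ∀ n, 0 ≤ aperyCoeff n * (chainSeq (d + 1) l s r n : ℝ) := fun n =>
    mul_nonneg (aperyCoeff_nonneg n) (hc n)
  have h1 := tsum_chain l s r fun n => ENNReal.ofReal (aperyCoeff n)
  have h2 : ∑' m, ENNReal.ofReal (aperyCoeff m) *
      ENNReal.ofReal (chainSeq (d + 1) l s r m : ℝ) = ENNReal.ofReal S := by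
    rw [← h.tsum_eq, ENNReal.ofReal_tsum_of_nonneg hnn h.summable]
    exact tsum_congr fun m => (ENNReal.ofReal_mul (aperyCoeff_nonneg m)).symm
  set F : (Fin (d + 1) → ℕ) → ℝ := fun n => aperyCoeff (n 0) / ∏ j, (l j (n j) : ℝ) ^ s j with hF
  have hFn : ∀ n, 0 ≤ F n := fun n =>
    div_nonneg (aperyCoeff_nonneg _) (Finset.prod_nonneg fun j _ => by positivity)
  have h3 : ∑' n : chain r, ENNReal.ofReal (F n.1) = ENNReal.ofReal S := by
    rw [tsum_subtype (chain r) fun n => ENNReal.ofReal (F n), ← h2, ← h1]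
    refine tsum_congr fun n => ?_
    rw [Set.indicator_apply]
    refine if_congr Iff.rfl ?_ rfl
    rw [← ENNReal.ofReal_prod_of_nonneg (fun j _ => by positivity),
      ← ENNReal.ofReal_mul (aperyCoeff_nonneg _), hF]
    simp [Finset.prod_inv_distrib, div_eq_mul_inv]
  have h4 := ENNReal.hasSum_toReal (f := fun n : chain r => ENNReal.ofReal (F n.1))
    (by rw [h3]; exact ENNReal.ofReal_ne_top)
  rw [← ENNReal.tsum_toReal_eq (fun _ => ENNReal.ofReal_ne_top), h3,
    ENNReal.toReal_ofReal (h.nonneg hnn)] at h4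
  have h5 : HasSum (fun n : chain r => F n.1) S := by
    simpa only [ENNReal.toReal_ofReal (hFn _)] using h4
  exact h5

/-- The partial sum `b` need not lie in the family; only its first quotient is required to, and
further divisions stay inside. -/
lemma pow_divForm_mem {l : ℕ → ℕ} {M : ℕ → Submodule ℚ (ℕ → ℚ)}
    (hM : ∀ w, ∀ b ∈ M w, divForm l b ∈ M (w + 1)) {b : ℕ → ℚ} {w s : ℕ} (hs : 1 ≤ s)
    (hb : divForm l b ∈ M (w + 1)) : ((divForm l) ^ s) b ∈ M (s + w) := by
  induction s, hs using Nat.le_induction with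
  | base => rwa [pow_one, add_comm]
  | succ s hs ih =>
    rw [pow_succ', Module.End.mul_apply, show s + 1 + w = s + w + 1 by ring]
    exact hM _ _ ih

/-! ### Weight bounds, and exact weight for homogeneous chains. -/

lemma succ_mem_singleton (w : ℕ) : ∀ v ∈ ({w} : Set ℕ), v + 1 ∈ ({w + 1} : Set ℕ) := by
  simp

lemma chainSeq_mem_seqSpan {k : ℕ} (l : Fin k → ℕ → ℕ) (s : Fin k → ℕ) (r : Fin k → Ineq)
    (hs : ∀ j, 1 ≤ s j) (hl : ∀ j, l j = evenForm ∨ l j = oddForm) :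
    chainSeq k l s r ∈ seqSpan (∑ j, s j) := by
  induction k with
  | zero => exact evenSpan_le_seqSpan _ (single_mem_evenSpan (Nat.zero_le _))
  | succ k ih =>
    rw [chainSeq_succ, Fin.sum_univ_succ]
    exact pow_divForm_mem (fun w b hb => divForm_mem_seqSpan (hl 0) hb) (hs 0)
      (divForm_sum_mem_seqSpan (hl 0) (r 0) (ih _ _ _ (fun j => hs _) fun j => hl _))

lemma evenForm_ne_oddForm : evenForm ≠ oddForm := fun h => by
  simpa [evenForm, oddForm] using congrFun h 0

/-- The sequences that may follow in a homogeneous chain. -/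
noncomputable def homSpan (l : ℕ → ℕ) (w : ℕ) : Submodule ℚ (ℕ → ℚ) :=
  open Classical in if l = oddForm then oddSpan {w} else evenSpan {w}

lemma homSpan_even (w : ℕ) : homSpan evenForm w = evenSpan {w} := if_neg evenForm_ne_oddForm

lemma homSpan_odd (w : ℕ) : homSpan oddForm w = oddSpan {w} := if_pos rfl

lemma divForm_mem_homSpan {l : ℕ → ℕ} (hl : l = evenForm ∨ l = oddForm) (w : ℕ) (b : ℕ → ℚ)
    (hb : b ∈ homSpan l w) : divForm l b ∈ homSpan l (w + 1) := by
  have hw := succ_mem_singleton w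
  rcases hl with rfl | rfl
  · rw [homSpan_even] at hb ⊢
    exact divForm_even_mem hw hb
  · rw [homSpan_odd] at hb ⊢
    exact divForm_odd_mem hw hb

/-- A step with the standard symbol. -/
lemma divForm_sum_mem_homSpan {l l' : ℕ → ℕ} {q : Ineq} (hl : l = evenForm ∨ l = oddForm)
    (hl' : l' = evenForm ∨ l' = oddForm) (hq : l = l' ∨ IsStandard l q) {w : ℕ} {b : ℕ → ℚ}
    (hb : b ∈ homSpan l' w) : divForm l (partialSum q b) ∈ homSpan l (w + 1) := by
  have hw := succ_mem_singleton w
  rcases hl with rfl | rfl <;> rcases hl' with rfl | rfl <;>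
    simp only [homSpan_even, homSpan_odd] at hb ⊢
  -- For equal forms the two symbols differ by a diagonal term of the same parity and weight, so
  -- both are allowed.
  · have h1 := divForm_even_sum_even_mem hw hb
    cases q with
    | gt => exact h1
    | ge =>
      rw [partialSum_ge, map_add]
      exact add_mem h1 (divForm_even_mem hw hb)
  · rw [(hq.resolve_left evenForm_ne_oddForm).2 evenForm_ne_oddForm]
    exact divForm_even_sum_odd_mem hw hb
  · rw [(hq.resolve_left evenForm_ne_oddForm.symm).1 rfl]
    exact divForm_odd_sum_even_mem hw hb
  · have h1 := divForm_odd_sum_odd_mem hw hb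
    cases q with
    | gt => exact h1
    | ge =>
      rw [partialSum_ge, map_add]
      exact add_mem h1 (divForm_odd_mem hw hb)

/-- The final 0 of the chain acts as an even exponent of weight 0, so the last symbol must be the
standard one. -/
lemma divForm_sum_single_mem_homSpan {l : ℕ → ℕ} {q : Ineq} (hl : l = evenForm ∨ l = oddForm)
    (hq : IsStandard l q) : divForm l (partialSum q (Pi.single 0 1)) ∈ homSpan l (0 + 1) := by
  have h := single_mem_evenSpan (V := {0}) rfl
  rw [← homSpan_even] at h
  exact divForm_sum_mem_homSpan hl (Or.inl rfl) (Or.inr hq) h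

lemma chainSeq_mem_homSpan {d : ℕ} (l : Fin (d + 1) → ℕ → ℕ) (s : Fin (d + 1) → ℕ)
    (r : Fin (d + 1) → Ineq) (hs : ∀ j, 1 ≤ s j) (hl : ∀ j, l j = evenForm ∨ l j = oddForm)
    (hh : IsHomogeneous l r) : chainSeq (d + 1) l s r ∈ homSpan (l 0) (∑ j, s j) := by
  induction d with
  | zero =>
    rw [chainSeq_succ, Fin.sum_univ_succ]
    exact pow_divForm_mem (divForm_mem_homSpan (hl 0)) (hs 0)
      (divForm_sum_single_mem_homSpan (hl 0) hh.2)
  | succ d ih =>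
    rw [chainSeq_succ, Fin.sum_univ_succ]
    refine pow_divForm_mem (divForm_mem_homSpan (hl 0)) (hs 0) ?_
    exact divForm_sum_mem_homSpan (hl 0) (hl 1) (hh.1 0)
      (ih (fun j => l j.succ) (fun j => s j.succ) (fun j => r j.succ) (fun j => hs _)
        (fun j => hl _) ⟨fun j => hh.1 j.succ, hh.2⟩)

/-- If the first linear form is `n`, it may be replaced by `2n`. -/
lemma chainSeq_of_id {d : ℕ} {l : Fin (d + 1) → ℕ → ℕ} (h : l 0 = fun n => n)
    (s : Fin (d + 1) → ℕ) (r : Fin (d + 1) → Ineq) : chainSeq (d + 1) l s r =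
      (2 : ℚ) ^ s 0 • ((divForm evenForm) ^ s 0) (partialSum (r 0)
        (chainSeq d (fun j => l j.succ) (fun j => s j.succ) (fun j => r j.succ))) := by
  rw [chainSeq_succ]
  funext n
  rw [Pi.smul_apply, divForm_pow_apply, divForm_pow_apply, h, evenForm, smul_eq_mul,
    Nat.cast_mul, mul_pow, mul_div_assoc', Nat.cast_ofNat,
    mul_div_mul_left _ _ (pow_ne_zero _ two_ne_zero)]

/-! ### Passage to CMZVs and the theorem. -/

lemma cmzv_le_cmzvLE {v w : ℕ} (h : v ≤ w) : cmzv 4 v ≤ cmzvLE 4 w :=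
  Submodule.span_mono fun _ hx => ⟨v, h, hx⟩

lemma pairsInto_evenSpan {w : ℕ} {b : ℕ → ℚ} (hb : b ∈ evenSpan {w}) :
    PairsInto (cmzv 4 w) b := by
  refine pairsInto_of_mem_span ?_ hb
  rintro _ ⟨v, rfl, β, h, rfl⟩
  exact h.pairsInto_even

lemma pairsInto_oddSpan {w : ℕ} {b : ℕ → ℚ} (hb : b ∈ oddSpan {w}) :
    PairsInto ((cmzv 4 w).map (LinearMap.mulLeft ℚ Complex.I)) b := by
  refine pairsInto_of_mem_span ?_ hb
  rintro _ ⟨v, rfl, β, h, rfl⟩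
  exact h.pairsInto_odd

lemma PairsInto.mono {M M' : Submodule ℚ ℂ} (h : M ≤ M') {b : ℕ → ℚ} (hb : PairsInto M b) :
    PairsInto M' b := by
  obtain ⟨S, h1, h2⟩ := hb
  exact ⟨S, h1, h h2⟩

lemma pairsInto_evenSpan_le {w : ℕ} {b : ℕ → ℚ} (hb : b ∈ evenSpan (Set.Iic w)) :
    PairsInto (cmzvLE 4 w) b := by
  refine pairsInto_of_mem_span ?_ hb
  rintro _ ⟨v, hv, β, h, rfl⟩
  exact h.pairsInto_even.mono (cmzv_le_cmzvLE hv)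

lemma pairsInto_oddSpan_le {w : ℕ} {b : ℕ → ℚ} (hb : b ∈ oddSpan (Set.Iic w)) :
    PairsInto ((cmzvLE 4 w).map (LinearMap.mulLeft ℚ Complex.I)) b := by
  refine pairsInto_of_mem_span ?_ hb
  rintro _ ⟨v, hv, β, h, rfl⟩
  exact h.pairsInto_odd.mono (Submodule.map_mono (cmzv_le_cmzvLE hv))

lemma le_tensorQi (M : Submodule ℚ ℂ) {x : ℂ} (hx : x ∈ M) : x ∈ tensorQi M :=
  Submodule.subset_span hx

lemma map_I_le_tensorQi (M : Submodule ℚ ℂ) {x : ℂ}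
    (hx : x ∈ M.map (LinearMap.mulLeft ℚ Complex.I)) : x ∈ tensorQi M := by
  obtain ⟨y, hy, rfl⟩ := Submodule.mem_map.1 hx
  exact Submodule.smul_mem _ (⟨Complex.I, Algebra.subset_adjoin rfl⟩ :
    Algebra.adjoin ℚ {Complex.I}) (le_tensorQi M hy)

theorem mainTheorem4 (d : ℕ) (s : Fin (d + 1) → ℕ) (hs : ∀ j, 1 ≤ s j)
    (l : Fin (d + 1) → ℕ → ℕ) (hl : ∀ j, j ≠ 0 → l j = evenForm ∨ l j = oddForm)
    (r : Fin (d + 1) → Ineq) (hdef : SeriesDefined l r) :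
    (l 0 = (fun n => n) → r 0 = Ineq.gt →
      ∃ S : ℝ, HasAperySum l s r S ∧
        (S : ℂ) ∈ cmzvLE 4 (∑ j, s j) ∧
        (IsHomogeneous l r → (S : ℂ) ∈ cmzv 4 (∑ j, s j))) ∧
    (l 0 = oddForm → r 0 = Ineq.ge →
      ∃ S : ℝ, HasAperySum l s r S ∧
        (∃ y ∈ cmzvLE 4 (∑ j, s j), (S : ℂ) = Complex.I * y) ∧
        (IsHomogeneous l r → ∃ y ∈ cmzv 4 (∑ j, s j), (S : ℂ) = Complex.I * y)) ∧
    (l 0 = evenForm ∨ l 0 = oddForm →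
      ∃ S : ℝ, HasAperySum l s r S ∧
        (S : ℂ) ∈ tensorQi (cmzvLE 4 (∑ j, s j)) ∧
        (IsHomogeneous l r → (S : ℂ) ∈ tensorQi (cmzv 4 (∑ j, s j)))) := by
  have hs' : ∀ j : Fin d, 1 ≤ s j.succ := fun j => hs _
  have hl' : ∀ j : Fin d, l j.succ = evenForm ∨ l j.succ = oddForm := fun j =>
    hl _ (Fin.succ_ne_zero j)
  have htail := chainSeq_mem_seqSpan _ _ (fun j => r j.succ) hs' hl'
  refine ⟨fun h0 hr => ?_, fun h0 hr => ?_, fun h0 => ?_⟩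
  · have h1 : chainSeq (d + 1) l s r ∈ evenSpan (Set.Iic (∑ j, s j)) := by
      -- The form `n` is half of `2n`; the power of 2 is absorbed by the rational span.
      rw [chainSeq_of_id h0, hr, Fin.sum_univ_succ]
      exact Submodule.smul_mem _ _ (pow_divForm_mem (M := fun w => evenSpan (Set.Iic w))
        (fun w b hb => divForm_even_mem (succ_mem_Iic_succ w) hb) (hs 0)
        (divForm_even_sum_mem htail))
    obtain ⟨S, hS, hS'⟩ := pairsInto_evenSpan_le h1
    refine ⟨S, hasAperySum_of_hasSum hS, hS', fun hh => ?_⟩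
    have h2 : chainSeq (d + 1) l s r ∈ evenSpan {∑ j, s j} := by
      have hst : IsStandard evenForm Ineq.gt := ⟨fun h => absurd h evenForm_ne_oddForm, fun _ => rfl⟩
      rw [chainSeq_of_id h0, hr, Fin.sum_univ_succ, ← homSpan_even]
      refine Submodule.smul_mem _ _ (pow_divForm_mem (divForm_mem_homSpan (Or.inl rfl)) (hs 0) ?_)
      cases d with
      | zero => exact divForm_sum_single_mem_homSpan (Or.inl rfl) hst
      | succ d =>
        exact divForm_sum_mem_homSpan (Or.inl rfl) (hl' 0) (Or.inr hst)
          (chainSeq_mem_homSpan _ _ _ hs' hl' ⟨fun j => hh.1 j.succ, hh.2⟩)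
    obtain ⟨T, hT, hT'⟩ := pairsInto_evenSpan h2
    rwa [hS.unique hT]
  · have h1 : chainSeq (d + 1) l s r ∈ oddSpan (Set.Iic (∑ j, s j)) := by
      rw [chainSeq_succ, hr, h0, Fin.sum_univ_succ]
      exact pow_divForm_mem (M := fun w => oddSpan (Set.Iic w))
        (fun w b hb => divForm_odd_mem (succ_mem_Iic_succ w) hb) (hs 0) (divForm_odd_sum_mem htail)
    obtain ⟨S, hS, hS'⟩ := pairsInto_oddSpan_le h1
    obtain ⟨y, hy, hy'⟩ := Submodule.mem_map.1 hS'
    refine ⟨S, hasAperySum_of_hasSum hS, ⟨y, hy, hy'.symm⟩, fun hh => ?_⟩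
    have hl0 : ∀ j, l j = evenForm ∨ l j = oddForm := fun j => Fin.cases (Or.inr h0) hl' j
    have h2 := chainSeq_mem_homSpan l s r hs hl0 hh
    rw [h0, homSpan_odd] at h2
    obtain ⟨T, hT, hT'⟩ := pairsInto_oddSpan h2
    obtain ⟨y, hy, hy'⟩ := Submodule.mem_map.1 hT'
    exact ⟨y, hy, by rw [hS.unique hT]; exact hy'.symm⟩
  · have hl0 : ∀ j, l j = evenForm ∨ l j = oddForm := fun j => Fin.cases h0 hl' j
    have h1 := chainSeq_mem_seqSpan l s r hs hl0
    -- The even part contributes a CMZV combination and the odd part `i` times one, whence the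
    -- extension of scalars to `ℚ[i]`.
    obtain ⟨b₀, hb₀, b₁, hb₁, hb⟩ := Submodule.mem_sup.1 h1
    obtain ⟨S₀, hS₀, hS₀'⟩ := pairsInto_evenSpan_le hb₀
    obtain ⟨S₁, hS₁, hS₁'⟩ := pairsInto_oddSpan_le hb₁
    have hS : HasSum (fun n => aperyCoeff n * (chainSeq (d + 1) l s r n : ℝ)) (S₀ + S₁) := by
      rw [← hb]
      simpa [mul_add] using hS₀.add hS₁
    refine ⟨S₀ + S₁, hasAperySum_of_hasSum hS, ?_, fun hh => ?_⟩
    · rw [Complex.ofReal_add]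
      exact add_mem (le_tensorQi _ hS₀') (map_I_le_tensorQi _ hS₁')
    have h2 := chainSeq_mem_homSpan l s r hs hl0 hh
    -- A homogeneous chain has a single parity, that of its first form, and the sum is unique.
    rcases h0 with h0 | h0
    · rw [h0, homSpan_even] at h2
      obtain ⟨T, hT, hT'⟩ := pairsInto_evenSpan h2
      rw [hS.unique hT]
      exact le_tensorQi _ hT'
    · rw [h0, homSpan_odd] at h2
      obtain ⟨T, hT, hT'⟩ := pairsInto_oddSpan h2
      rw [hS.unique hT]
      exact map_I_le_tensorQi _ hT'
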